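/- Let $d\ge 1$, $L\ge 1$, and let $\mathbb U$ be the grid $[a_1,\dots,a_L]^d$; write $x^u\in\{1,\dots,L\}$ for the $u$-th support index of $x\in\mathbb U$. Let $P,Q$ be probability distributions on $\mathbb U$ with mass functions $p,q$, where $q>0$ on $\mathbb U$. For $\varpi>0$ put $$F_\varpi(P\|Q)=\sum_{x\in\mathbb U}p(x)e^{\varpi p(x)/q(x)},\qquad D_\varpi(P\|Q)=\log F_\varpi(P\|Q)-\varpi .$$ **Kernel estimator.** For an integer $\tilde d$ with $1\le\tilde d<(L-1)/2$ let $c=(2\tilde d+1)^d-1$, let $\mathbb V(x)=\{y\in\mathbb U: y\ne x,\ |y^u-x^u|\le\tilde d\ \text{for all }u\}$, and let $W(s,x,y)$ be $1-s$ if $y=x$, $s/c$ if $y\in\mathbb V(x)$, and $0$ otherwise. From a sample $Z_1,\dots,Z_M$ form the relative frequencies $\hat p(x)=\frac1M\sum_k I_{\{Z_k=x\}}$, the smoothing parameter $$\hat s_0=\frac{1-\sum_x\hat p(x)^2+\frac1c\sum_x\sum_{y\in\mathbb V(x)}\hat p(x)\hat p(y)}{1+\frac1{c^2}\sum_x\sum_{y\in\mathbb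 V(x)}\hat p(y)+(M-1)\Big\{\sum_x\hat p(x)^2+\frac1{c^2}\sum_x\big[\sum_{y\in\mathbb V(x)}\hat p(y)\big]^2-\frac2c\sum_x\sum_{y\in\mathbb V(x)}\hat p(x)\hat p(y)\Big\}},$$ and the estimator $\widetilde p_{\hat s_0}(x)=\frac1M\sum_{k=1}^M W(\hat s_0,x,Z_k)$. **Ensemble estimator.** Let $0<\mu<1$, $T\ge d+1$, let $\tilde d_1,\dots,\tilde d_T$ be window sizes as above, and let $\epsilon\ge 1/T$ (so that the constraints below can be met). For a sample size $\varGamma$ let $M=\lfloor\mu\varGamma\rfloor$ and $N=\varGamma-M$. Let $X_1,X_2,\dots$ be i.i.d. with law $P$ and $Y_1,Y_2,\dots$ i.i.d. with law $Q$. For each $l$, let $\widetilde p^{(l)}$ and $\widetilde q^{(l)}$ be the kernel estimators with window $\tilde d_l$ built from $X_{N+1},\dots,X_{N+M}$ and $Y_1,\dots,Y_M$, respectively, and set $$\hat F_{l}=\frac1N\sum_{i=1}^N \exp\Big(\varpi\,\frac{\widetilde p^{(l)}(X_i)}{\widetilde q^{(l)}(X_i)}\Big),\qquad \hat F_\lambda=\sum_{l=1}^T\lambda_l\hat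 F_{l}.$$ Let $\lambda^*=\lambda^*(\varGamma)$ be any solution of the problem of minimizing $\delta$ over $(\lambda,\delta)$ subject to $\sum_l\lambda_l=1$, $\|\lambda\|_2^2\le\epsilon$ and $\big|\sum_l\lambda_l\varphi_j(l)\varGamma^{1/2-j/2d}\big|\le\delta$ for $j=1,\dots,d$, where $\varphi_j(l)=\varDelta_l^{j/d}$ and $\varDelta_l=\big[\frac{2\tilde d_l+1}{L}\big]^d\sqrt M$. Fix $0<\eta<e^{\varpi}$ (so that $\eta<F_\varpi(P\|Q)$) and $\kappa\in\mathbb R$. For a weight vector $\lambda$ call the samples degenerate if $\widetilde q^{(l)}(X_i)=0$ for some $i\le N$ and some $l$ with $\lambda_l\neq0$, or if $\hat F_\lambda<\eta$. Let $\hat D_{\lambda}=\log\hat F_\lambda-\varpi$ on non-degenerate samples and $\hat D_\lambda=\kappa$ on degenerate ones, and let $\hat D_\varpi=\hat D_{\lambda^*}$. **Claim.** For every $\varGamma$ an optimal $\lambda^*$ exists. For every choice of optimal weights $\lambda^*(\varGamma)$, the estimator $\hat D_\varpi$ is square integrable, the samples are degenerate with probability $O(e^{-c\varGamma})$ for some $c>0$,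 and, as $\varGamma\to\infty$, $$\mathrm{MSE}(\hat D_\varpi)=\mathbb E\big[(\hat D_\varpi-D_\varpi(P\|Q))^2\big]=O(\varGamma^{-1}).$$ Each individual estimator ($\lambda$ the $l$-th unit vector, that is, $\log\hat F_l-\varpi$) is square integrable and has mean squared error $O(\varGamma^{-j/d})$ for every real $j\in(0,d]$; and $\varGamma^{-1}=o(\varGamma^{-j/d})$ for $0<j<d$. The constants may depend on everything except $\varGamma$. -/

import Mathlib

open Filter MeasureTheory ProbabilityTheory Asymptotics

namespace MIDiv

/-- The support `[a₁, …, a_L]^d`. A point is recorded by its `d` support indexes, since the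
window measures distances between support indexes. -/
abbrev Grid (d L : ℕ) : Type := Fin d → Fin L

/-- `p` is a probability mass function on the grid. -/
def IsPmf {d L : ℕ} (p : Grid d L → ℝ) : Prop :=
  (∀ x, 0 ≤ p x) ∧ ∑ x, p x = 1

/-- `F_ϖ(P ‖ Q) = ∑ p e^{ϖ p / q}`. -/
noncomputable def miF {d L : ℕ} (ϖ : ℝ) (p q : Grid d L → ℝ) : ℝ :=
  ∑ x, p x * Real.exp (ϖ * (p x / q x))

/-- The message identification divergence `D_ϖ(P ‖ Q) = log F_ϖ(P ‖ Q) - ϖ`. -/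
noncomputable def miDivergence {d L : ℕ} (ϖ : ℝ) (p q : Grid d L → ℝ) : ℝ :=
  Real.log (miF ϖ p q) - ϖ

/-- `y` lies in the window of size `r` around `x`: in every coordinate the support indexes
differ by at most `r`. -/
def InWindow {d L : ℕ} (r : ℕ) (x y : Grid d L) : Prop :=
  ∀ u, |((x u : ℕ) : ℤ) - ((y u : ℕ) : ℤ)| ≤ (r : ℤ)

instance {d L : ℕ} (r : ℕ) (x y : Grid d L) : Decidable (InWindow r x y) :=
  inferInstanceAs (Decidable (∀ u, |((x u : ℕ) : ℤ) - ((y u : ℕ) : ℤ)| ≤ (r : ℤ)))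

/-- The punctured window around `x` inside the grid. -/
def puncturedWindow {d L : ℕ} (r : ℕ) (x : Grid d L) : Finset (Grid d L) :=
  Finset.univ.filter fun y => y ≠ x ∧ InWindow r x y

/-- `(2r+1)^d - 1`. -/
def windowCount (d r : ℕ) : ℝ := (2 * (r : ℝ) + 1) ^ d - 1

/-- The weight window function `W(s, x, y)`. -/
noncomputable def weight {d L : ℕ} (r : ℕ) (s : ℝ) (x y : Grid d L) : ℝ :=
  if y = x then 1 - s
  else if InWindow r x y then s / windowCount d r
  else 0

/-- The plug-in estimator (relative frequencies) from the first `n` terms of `z`. -/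
noncomputable def plugIn {d L : ℕ} (n : ℕ) (z : ℕ → Grid d L) (x : Grid d L) : ℝ :=
  (1 / (n : ℝ)) * ∑ k ∈ Finset.range n, if z k = x then 1 else 0

/-- The weighted-window kernel estimator with parameter `s` from the first `n` terms of `z`. -/
noncomputable def kernelEst {d L : ℕ} (r : ℕ) (s : ℝ) (n : ℕ) (z : ℕ → Grid d L)
    (x : Grid d L) : ℝ :=
  (1 / (n : ℝ)) * ∑ k ∈ Finset.range n, ∑ y, weight r s x y * if z k = y then 1 else 0

/-- The denominator `Φ(p, n, r)` of the smoothing parameter. -/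
noncomputable def smoothDen {d L : ℕ} (r n : ℕ) (p : Grid d L → ℝ) : ℝ :=
  1 + (∑ x, ∑ y ∈ puncturedWindow r x, p y) / windowCount d r ^ 2
    + ((n : ℝ) - 1) *
      (∑ x, p x ^ 2
        + (∑ x, (∑ y ∈ puncturedWindow r x, p y) ^ 2) / windowCount d r ^ 2
        - 2 * (∑ x, ∑ y ∈ puncturedWindow r x, p x * p y) / windowCount d r)

/-- The smoothing parameter as a function of a mass function `p`. -/
noncomputable def smoothPar {d L : ℕ} (r n : ℕ) (p : Grid d L → ℝ) : ℝ :=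
  (1 - ∑ x, p x ^ 2 + (∑ x, ∑ y ∈ puncturedWindow r x, p x * p y) / windowCount d r)
    / smoothDen r n p

/-- The kernel estimator with the data-driven smoothing parameter, obtained by inserting the
plug-in estimator into `smoothPar`. -/
noncomputable def adaptiveEst {d L : ℕ} (r n : ℕ) (z : ℕ → Grid d L) (x : Grid d L) : ℝ :=
  kernelEst r (smoothPar r n (plugIn n z)) n z x

/-- `M = μΓ`, rounded down to an integer. -/
noncomputable def sizeM (μ : ℝ) (Γ : ℕ) : ℕ := ⌊μ * (Γ : ℝ)⌋₊

/-- `N = Γ - M`. -/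
noncomputable def sizeN (μ : ℝ) (Γ : ℕ) : ℕ := Γ - sizeM μ Γ

/-- The estimate of `p` from the second part `X_{N+1}, …, X_{N+M}` of the sample of `P`. -/
noncomputable def estP {d L : ℕ} (μ : ℝ) (Γ r : ℕ) (xs : ℕ → Grid d L) (x : Grid d L) : ℝ :=
  adaptiveEst r (sizeM μ Γ) (fun k => xs (sizeN μ Γ + k)) x

/-- The estimate of `q` from `Y_1, …, Y_M`. -/
noncomputable def estQ {d L : ℕ} (μ : ℝ) (Γ r : ℕ) (ys : ℕ → Grid d L) (x : Grid d L) : ℝ :=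
  adaptiveEst r (sizeM μ Γ) ys x

/-- The estimator of `F_ϖ(P ‖ Q)` with window size `r`: an average over `X_1, …, X_N`. -/
noncomputable def estF {d L : ℕ} (ϖ μ : ℝ) (Γ r : ℕ) (xs ys : ℕ → Grid d L) : ℝ :=
  (1 / (sizeN μ Γ : ℝ)) * ∑ i ∈ Finset.range (sizeN μ Γ),
    Real.exp (ϖ * (estP μ Γ r xs (xs i) / estQ μ Γ r ys (xs i)))

/-- The weighted ensemble `∑_l λ_l F̂_{r_l}`. -/
noncomputable def ensembleF {d L T : ℕ} (ϖ μ : ℝ) (r : Fin T → ℕ) (w : Fin T → ℝ) (Γ : ℕ)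
    (xs ys : ℕ → Grid d L) : ℝ :=
  ∑ l, w l * estF ϖ μ Γ (r l) xs ys

/-- The samples are degenerate for the ensemble with weights `w`: a denominator needed in
`F̂_{r_l}` with `w_l ≠ 0` vanishes, or the ensemble estimate of `F_ϖ` falls below the
threshold `η`. -/
def Degenerate {d L T : ℕ} (ϖ μ η : ℝ) (r : Fin T → ℕ) (w : Fin T → ℝ) (Γ : ℕ)
    (xs ys : ℕ → Grid d L) : Prop :=
  (∃ l, w l ≠ 0 ∧ ∃ i < sizeN μ Γ, estQ μ Γ (r l) ys (xs i) = 0) ∨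
    ensembleF ϖ μ r w Γ xs ys < η

open Classical in
/-- The estimator `log F̂_w - ϖ` of the divergence; it returns the fixed value `κ` on
degenerate samples. -/
noncomputable def estD {d L T : ℕ} (ϖ μ η κ : ℝ) (r : Fin T → ℕ) (w : Fin T → ℝ) (Γ : ℕ)
    (xs ys : ℕ → Grid d L) : ℝ :=
  if Degenerate ϖ μ η r w Γ xs ys then κ else Real.log (ensembleF ϖ μ r w Γ xs ys) - ϖ

/-- `φ_j(l) = Δ_l^{j/d}` with `Δ_l = ((2 r_l + 1) / L)^d √M`. -/
noncomputable def phi (d L : ℕ) (μ : ℝ) (Γ r j : ℕ) : ℝ :=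
  (((2 * (r : ℝ) + 1) / (L : ℝ)) ^ d * Real.sqrt (sizeM μ Γ)) ^ ((j : ℝ) / (d : ℝ))

/-- The constraints on a weight vector `w` and a level `δ`. -/
def Feasible {T : ℕ} (d L : ℕ) (μ ε : ℝ) (r : Fin T → ℕ) (Γ : ℕ) (w : Fin T → ℝ) (δ : ℝ) :
    Prop :=
  ∑ l, w l = 1 ∧
  (∀ j ∈ Finset.Icc 1 d,
    |∑ l, w l * phi d L μ Γ (r l) j * (Γ : ℝ) ^ (1 / 2 - (j : ℝ) / (2 * (d : ℝ)))| ≤ δ) ∧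
  ∑ l, w l ^ 2 ≤ ε

/-- `w` is an optimal weight vector: it attains the least feasible level `δ`. -/
def IsOptimalWeight {T : ℕ} (d L : ℕ) (μ ε : ℝ) (r : Fin T → ℕ) (Γ : ℕ) (w : Fin T → ℝ) :
    Prop :=
  ∃ δ, Feasible d L μ ε r Γ w δ ∧ ∀ w' δ', Feasible d L μ ε r Γ w' δ' → δ ≤ δ'

end MIDiv

/-!
Every estimator in question has mean squared error `O(Γ⁻¹)`, because on a finite grid the kernel
estimator is a deterministic `O(1/M)` perturbation of the relative frequencies. The denominator of
the smoothing parameter contains `(M - 1)` times `smoothDefect`, the squared distance of a mass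
function from its window averages. No mass function agrees with its window averages, as windows at
the boundary of the grid are cut off (`smoothDefect_pos`); by compactness of the simplex
`smoothDefect` is bounded below by a positive constant, so that `0 ≤ ŝ₀ ≤ K / M` for every sample
(`exists_smoothPar_le`, `exists_abs_adaptiveEst_sub_le`).

The estimator `F̂_l` is the value of the functional `(a, b, c) ↦ ∑ a e^{ϖ b / c}` at
estimates of `(p, p, q)`. The functional is differentiable there, so the error of `F̂_l`, and of
every ensemble with bounded weights summing to one, is at most of the order of the deviation of
the relative frequencies plus `1/Γ`, as long as that deviation is small (`exists_sq_error_le`). As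
`η < e^ϖ ≤ F_ϖ(P ‖ Q)` (`exp_le_miF`), such samples are not degenerate, and the logarithm is
Lipschitz on `[η, ∞)`. The squared deviation has expectation `O(Γ⁻¹)`
(`exists_integral_sampleDev_le`).

The remaining samples have exponentially small probability by Hoeffding's inequality
(`exists_measureReal_sampleDev_le`). Their contribution is negligible, since `log F̂` grows at most
polynomially in `Γ` (`exists_abs_error_le`): relative frequencies have denominator `M`, which makes
a value of the kernel estimator either `0` or at least of order `M⁻⁴` (`exists_le_adaptiveEst`).

The constraint `‖λ‖² ≤ ε` bounds the optimal weights, and unit vectors are bounded as well, so both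
rates follow from `isBigO_degenerate_and_mse`. No relation between the two samples is needed, since
the error is bounded by a sum of terms that each involve one sample.
-/

namespace MIDiv

variable {d L : ℕ}

/-! ### Windows in the grid -/

lemma two_le_windowCount {r : ℕ} (hd : 1 ≤ d) (hr : 1 ≤ r) : 2 ≤ windowCount d r := by
  have hr' : (1 : ℝ) ≤ r := by exact_mod_cast hr
  have h3 : (3 : ℝ) ≤ 2 * r + 1 := by linarith
  have : (2 * (r : ℝ) + 1) ^ 1 ≤ (2 * (r : ℝ) + 1) ^ d := pow_le_pow_right₀ (by linarith) hd
  unfold windowCount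
  linarith

/-- The window with its centre is a product of intervals of indexes. -/
lemma insert_puncturedWindow (r : ℕ) (x : Grid d L) :
    insert x (puncturedWindow r x) = Fintype.piFinset fun u =>
      Finset.univ.filter fun j : Fin L => |((x u : ℕ) : ℤ) - ((j : ℕ) : ℤ)| ≤ (r : ℤ) := by
  ext y
  simp only [puncturedWindow, Finset.mem_insert, Finset.mem_filter, Finset.mem_univ,
    true_and, Fintype.mem_piFinset]
  unfold InWindow
  by_cases h : y = x
  · simp [h]
  · simp [h]

lemma card_index_interval_le (r : ℕ) (i : Fin L) :
    (Finset.univ.filter fun j : Fin L => |((i : ℕ) : ℤ) - ((j : ℕ) : ℤ)| ≤ (r : ℤ)).card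
      ≤ 2 * r + 1 := by
  have h : (Finset.univ.filter fun j : Fin L => |((i : ℕ) : ℤ) - ((j : ℕ) : ℤ)| ≤ (r : ℤ)).card
      ≤ (Finset.Icc (((i : ℕ) : ℤ) - r) (((i : ℕ) : ℤ) + r)).card := by
    refine Finset.card_le_card_of_injOn (fun j => ((j : ℕ) : ℤ)) ?_ ?_
    · intro j hj
      simp only [Finset.coe_filter, Finset.mem_univ, true_and, Set.mem_ofPred_eq, abs_le] at hj
      simp only [Finset.coe_Icc, Set.mem_Icc]
      omega
    · intro a _ b _ hab
      exact Fin.ext (by simpa using hab)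
  rw [Int.card_Icc] at h
  omega

lemma card_index_interval_lt {r : ℕ} (hr : 1 ≤ r) {i : Fin L} (hi : (i : ℕ) = 0) :
    (Finset.univ.filter fun j : Fin L => |((i : ℕ) : ℤ) - ((j : ℕ) : ℤ)| ≤ (r : ℤ)).card
      < 2 * r + 1 := by
  have h : (Finset.univ.filter fun j : Fin L => |((i : ℕ) : ℤ) - ((j : ℕ) : ℤ)| ≤ (r : ℤ)).card
      ≤ (Finset.range (r + 1)).card := by
    refine Finset.card_le_card_of_injOn (fun j => (j : ℕ)) ?_ ?_
    · intro j hj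
      simp only [Finset.coe_filter, Finset.mem_univ, true_and, Set.mem_ofPred_eq, abs_le] at hj
      simp only [Finset.coe_range, Set.mem_Iio]
      omega
    · intro a _ b _ hab
      exact Fin.ext (by simpa using hab)
  rw [Finset.card_range] at h
  omega

lemma notMem_puncturedWindow (r : ℕ) (x : Grid d L) : x ∉ puncturedWindow r x := by
  simp [puncturedWindow]

lemma card_puncturedWindow_le (r : ℕ) (x : Grid d L) :
    ((puncturedWindow r x).card : ℝ) ≤ windowCount d r := by
  have h : (insert x (puncturedWindow r x)).card ≤ (2 * r + 1) ^ d := by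
    rw [insert_puncturedWindow, Fintype.card_piFinset]
    calc _ ≤ ∏ _u : Fin d, (2 * r + 1) :=
          Finset.prod_le_prod' fun u _ => card_index_interval_le r (x u)
      _ = _ := by simp
  rw [Finset.card_insert_of_notMem (notMem_puncturedWindow r x)] at h
  have h' : ((puncturedWindow r x).card : ℝ) + 1 ≤ (2 * (r : ℝ) + 1) ^ d := by exact_mod_cast h
  unfold windowCount
  linarith

/-- At the boundary of the grid the window is cut off. -/
lemma card_puncturedWindow_lt {r : ℕ} (hr : 1 ≤ r) {x : Grid d L} {u : Fin d}
    (hx : (x u : ℕ) = 0) : ((puncturedWindow r x).card : ℝ) < windowCount d r := by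
  have h : (insert x (puncturedWindow r x)).card < (2 * r + 1) ^ d := by
    rw [insert_puncturedWindow, Fintype.card_piFinset]
    calc _ < ∏ _u : Fin d, (2 * r + 1) := by
          refine Finset.prod_lt_prod (fun v _ => Finset.card_pos.2 ⟨x v, by simp⟩)
            (fun v _ => card_index_interval_le r (x v))
            ⟨u, Finset.mem_univ _, card_index_interval_lt hr hx⟩
      _ = _ := by simp
  rw [Finset.card_insert_of_notMem (notMem_puncturedWindow r x)] at h
  have h' : ((puncturedWindow r x).card : ℝ) + 1 < (2 * (r : ℝ) + 1) ^ d := by exact_mod_cast h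
  unfold windowCount
  linarith

/-! ### The smoothing parameter -/

/-- The squared distance of `p` from its window averages. The averages are taken with the full
window count, also at points whose window is cut off by the boundary of the grid. -/
noncomputable def smoothDefect (r : ℕ) (p : Grid d L → ℝ) : ℝ :=
  ∑ x, (p x - (∑ y ∈ puncturedWindow r x, p y) / windowCount d r) ^ 2

lemma smoothDen_eq (r n : ℕ) (p : Grid d L → ℝ) :
    smoothDen r n p = 1 + (∑ x, ∑ y ∈ puncturedWindow r x, p y) / windowCount d r ^ 2
      + ((n : ℝ) - 1) * smoothDefect r p := by
  have h : smoothDefect r p = ∑ x, p x ^ 2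
        + (∑ x, (∑ y ∈ puncturedWindow r x, p y) ^ 2) / windowCount d r ^ 2
        - 2 * (∑ x, ∑ y ∈ puncturedWindow r x, p x * p y) / windowCount d r := by
    rw [smoothDefect, mul_div_assoc, Finset.sum_div, Finset.sum_div, Finset.mul_sum,
      ← Finset.sum_add_distrib, ← Finset.sum_sub_distrib]
    refine Finset.sum_congr rfl fun x _ => ?_
    rw [← Finset.mul_sum]
    ring
  rw [smoothDen, h]

lemma IsPmf.le_one {p : Grid d L → ℝ} (hp : IsPmf p) (x : Grid d L) : p x ≤ 1 := by
  rw [← hp.2]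
  exact Finset.single_le_sum (fun y _ => hp.1 y) (Finset.mem_univ x)

lemma IsPmf.sum_window_nonneg {p : Grid d L → ℝ} (hp : IsPmf p) (r : ℕ) (x : Grid d L) :
    0 ≤ ∑ y ∈ puncturedWindow r x, p y :=
  Finset.sum_nonneg fun y _ => hp.1 y

lemma IsPmf.sum_window_le_one {p : Grid d L → ℝ} (hp : IsPmf p) (r : ℕ) (x : Grid d L) :
    ∑ y ∈ puncturedWindow r x, p y ≤ 1 := by
  rw [← hp.2]
  exact Finset.sum_le_sum_of_subset_of_nonneg (Finset.subset_univ _) fun y _ _ => hp.1 y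

lemma IsPmf.nonempty {p : Grid d L → ℝ} (hp : IsPmf p) : Nonempty (Grid d L) := by
  by_contra h
  rw [not_nonempty_iff] at h
  simpa using hp.2

/-- No mass function agrees with its window averages. At a maximizer with least first index,
either the window is cut off by the boundary or it contains a point of smaller mass, so that the
window average lies below the maximum. -/
lemma smoothDefect_pos {r : ℕ} (hd : 1 ≤ d) (hr : 1 ≤ r) {p : Grid d L → ℝ} (hp : IsPmf p) :
    0 < smoothDefect r p := by
  have hc := two_le_windowCount hd hr
  have := hp.nonempty
  let u : Fin d := ⟨0, hd⟩
  obtain ⟨x₀, -, hx₀⟩ := Finset.exists_max_image (Finset.univ : Finset (Grid d L)) p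
    Finset.univ_nonempty
  obtain ⟨x, hx, hmin⟩ := Finset.exists_min_image
    (Finset.univ.filter fun x : Grid d L => p x = p x₀) (fun x => (x u : ℕ)) ⟨x₀, by simp⟩
  have hxm : p x = p x₀ := by simpa using hx
  have hmax : ∀ y, p y ≤ p x := fun y => hxm ▸ hx₀ y (Finset.mem_univ y)
  have hpos : 0 < p x := by
    by_contra hle
    have h0 : ∑ y, p y ≤ 0 := Finset.sum_nonpos fun y _ => (hmax y).trans (not_lt.1 hle)
    rw [hp.2] at h0
    linarith
  have hsum : ∑ y ∈ puncturedWindow r x, p y < windowCount d r * p x := by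
    by_cases h0 : (x u : ℕ) = 0
    · calc ∑ y ∈ puncturedWindow r x, p y ≤ (puncturedWindow r x).card • p x :=
            Finset.sum_le_card_nsmul _ _ _ fun y _ => hmax y
        _ = (puncturedWindow r x).card * p x := nsmul_eq_mul _ _
        _ < _ := mul_lt_mul_of_pos_right (card_puncturedWindow_lt hr h0) hpos
    · let y : Grid d L := Function.update x u ⟨(x u : ℕ) - 1, by omega⟩
      have hyu : (y u : ℕ) = (x u : ℕ) - 1 := by simp [y]
      have hyV : y ∈ puncturedWindow r x := by
        simp only [puncturedWindow, Finset.mem_filter, Finset.mem_univ, true_and]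
        refine ⟨fun h => ?_, fun v => ?_⟩
        · rw [h] at hyu
          omega
        · by_cases hv : v = u
          · subst hv
            rw [hyu, abs_le]
            omega
          · simp [y, Function.update_of_ne hv]
      have hlt : p y < p x := by
        refine lt_of_le_of_ne (hmax y) fun h => ?_
        have := hmin y (by simp [h, hxm])
        omega
      calc ∑ y ∈ puncturedWindow r x, p y < ∑ _y ∈ puncturedWindow r x, p x :=
            Finset.sum_lt_sum (fun y _ => hmax y) ⟨y, hyV, hlt⟩
        _ = (puncturedWindow r x).card * p x := by simp
        _ ≤ _ := mul_le_mul_of_nonneg_right (card_puncturedWindow_le r x) hpos.le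
  have hlt : (∑ y ∈ puncturedWindow r x, p y) / windowCount d r < p x := by
    rw [div_lt_iff₀ (by linarith)]
    linarith
  have hsq : 0 < (p x - (∑ y ∈ puncturedWindow r x, p y) / windowCount d r) ^ 2 :=
    pow_pos (by linarith) 2
  exact hsq.trans_le (Finset.single_le_sum
    (f := fun x => (p x - (∑ y ∈ puncturedWindow r x, p y) / windowCount d r) ^ 2)
    (fun y _ => sq_nonneg _) (Finset.mem_univ x))

/-- Compactness of the simplex makes the positivity of `smoothDefect` uniform. -/
lemma exists_pos_le_smoothDefect {r : ℕ} (hd : 1 ≤ d) (hr : 1 ≤ r) :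
    ∃ a : ℝ, 0 < a ∧ ∀ p : Grid d L → ℝ, IsPmf p → a ≤ smoothDefect r p := by
  by_cases hne : (stdSimplex ℝ (Grid d L)).Nonempty
  · have hcont : Continuous fun p : Grid d L → ℝ => smoothDefect r p := by
      unfold smoothDefect
      fun_prop
    obtain ⟨p₀, hp₀, hmin⟩ := (isCompact_stdSimplex ℝ (Grid d L)).exists_isMinOn hne
      hcont.continuousOn
    exact ⟨_, smoothDefect_pos hd hr hp₀, fun p hp => hmin hp⟩
  · exact ⟨1, one_pos, fun p hp => (hne ⟨p, hp⟩).elim⟩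

lemma smoothDefect_le {r : ℕ} (hd : 1 ≤ d) (hr : 1 ≤ r) {p : Grid d L → ℝ} (hp : IsPmf p) :
    smoothDefect r p ≤ Fintype.card (Grid d L) := by
  have hc := two_le_windowCount hd hr
  have h : ∀ x, (p x - (∑ y ∈ puncturedWindow r x, p y) / windowCount d r) ^ 2 ≤ 1 := fun x => by
    have h1 : (∑ y ∈ puncturedWindow r x, p y) / windowCount d r ≤ 1 := by
      rw [div_le_one (by linarith)]
      linarith [hp.sum_window_le_one r x]
    have h2 : 0 ≤ (∑ y ∈ puncturedWindow r x, p y) / windowCount d r :=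
      div_nonneg (hp.sum_window_nonneg r x) (by linarith)
    rw [sq_le_one_iff_abs_le_one, abs_le]
    constructor <;> linarith [hp.1 x, hp.le_one x]
  calc smoothDefect r p ≤ ∑ _x : Grid d L, (1 : ℝ) := Finset.sum_le_sum fun x _ => h x
    _ = _ := by simp

/-- The numerator of the smoothing parameter. -/
noncomputable def smoothNum (r : ℕ) (p : Grid d L → ℝ) : ℝ :=
  1 - ∑ x, p x ^ 2 + (∑ x, ∑ y ∈ puncturedWindow r x, p x * p y) / windowCount d r

lemma smoothPar_eq (r n : ℕ) (p : Grid d L → ℝ) :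
    smoothPar r n p = smoothNum r p / smoothDen r n p := rfl

lemma smoothNum_nonneg {r : ℕ} (hd : 1 ≤ d) (hr : 1 ≤ r) {p : Grid d L → ℝ} (hp : IsPmf p) :
    0 ≤ smoothNum r p := by
  have hc := two_le_windowCount hd hr
  have h1 : ∑ x, p x ^ 2 ≤ 1 := by
    rw [← hp.2]
    exact Finset.sum_le_sum fun x _ => pow_le_of_le_one (hp.1 x) (hp.le_one x) two_ne_zero
  have h2 : 0 ≤ (∑ x, ∑ y ∈ puncturedWindow r x, p x * p y) / windowCount d r :=
    div_nonneg (Finset.sum_nonneg fun x _ => Finset.sum_nonneg fun y _ =>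
      mul_nonneg (hp.1 x) (hp.1 y)) (by linarith)
  unfold smoothNum
  linarith

lemma smoothNum_le {r : ℕ} (hd : 1 ≤ d) (hr : 1 ≤ r) {p : Grid d L → ℝ} (hp : IsPmf p) :
    smoothNum r p ≤ 2 := by
  have hc := two_le_windowCount hd hr
  have h1 : 0 ≤ ∑ x, p x ^ 2 := Finset.sum_nonneg fun x _ => sq_nonneg _
  have h2 : (∑ x, ∑ y ∈ puncturedWindow r x, p x * p y) / windowCount d r ≤ 1 := by
    rw [div_le_one (by linarith)]
    calc ∑ x, ∑ y ∈ puncturedWindow r x, p x * p y ≤ ∑ x, p x := by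
          refine Finset.sum_le_sum fun x _ => ?_
          rw [← Finset.mul_sum]
          exact mul_le_of_le_one_right (hp.1 x) (hp.sum_window_le_one r x)
      _ ≤ _ := by rw [hp.2]; linarith
  unfold smoothNum
  linarith

lemma smoothDen_ge {r n : ℕ} (hd : 1 ≤ d) (hr : 1 ≤ r) (hn : 1 ≤ n) {a : ℝ}
    {p : Grid d L → ℝ} (hp : IsPmf p) (hap : a ≤ smoothDefect r p) :
    min 1 a * n ≤ smoothDen r n p := by
  have hc := two_le_windowCount hd hr
  have hn' : (1 : ℝ) ≤ n := by exact_mod_cast hn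
  have h1 : 0 ≤ (∑ x, ∑ y ∈ puncturedWindow r x, p y) / windowCount d r ^ 2 :=
    div_nonneg (Finset.sum_nonneg fun x _ => hp.sum_window_nonneg r x) (sq_nonneg _)
  have h2 : min 1 a * ((n : ℝ) - 1) ≤ smoothDefect r p * ((n : ℝ) - 1) :=
    mul_le_mul_of_nonneg_right ((min_le_right _ _).trans hap) (by linarith)
  rw [smoothDen_eq]
  linarith [min_le_left 1 a]

lemma smoothDen_le {r n : ℕ} (hd : 1 ≤ d) (hr : 1 ≤ r) (hn : 1 ≤ n)
    {p : Grid d L → ℝ} (hp : IsPmf p) :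
    smoothDen r n p ≤ (1 + 2 * Fintype.card (Grid d L)) * n := by
  have hc := two_le_windowCount hd hr
  have hn' : (1 : ℝ) ≤ n := by exact_mod_cast hn
  have h1 : (∑ x, ∑ y ∈ puncturedWindow r x, p y) / windowCount d r ^ 2
      ≤ Fintype.card (Grid d L) := by
    refine (div_le_self (Finset.sum_nonneg fun x _ => hp.sum_window_nonneg r x)
      (by nlinarith)).trans ?_
    calc ∑ x, ∑ y ∈ puncturedWindow r x, p y ≤ ∑ _x : Grid d L, (1 : ℝ) :=
          Finset.sum_le_sum fun x _ => hp.sum_window_le_one r x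
      _ = _ := by simp
  have h2 : ((n : ℝ) - 1) * smoothDefect r p ≤ ((n : ℝ) - 1) * Fintype.card (Grid d L) :=
    mul_le_mul_of_nonneg_left (smoothDefect_le hd hr hp) (by linarith)
  have h3 : (Fintype.card (Grid d L) : ℝ) ≤ Fintype.card (Grid d L) * n :=
    le_mul_of_one_le_right (by positivity) hn'
  rw [smoothDen_eq]
  linarith

/-! ### The kernel estimator as a small perturbation of the relative frequencies -/

lemma isPmf_plugIn {n : ℕ} (hn : 1 ≤ n) (z : ℕ → Grid d L) : IsPmf (plugIn n z) := by
  refine ⟨fun x => ?_, ?_⟩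
  · unfold plugIn
    positivity
  · unfold plugIn
    rw [← Finset.mul_sum, Finset.sum_comm]
    have hn' : (n : ℝ) ≠ 0 := by positivity
    simp [hn']

/-- Relative frequencies have denominator `n`. -/
lemma plugIn_eq_count (n : ℕ) (z : ℕ → Grid d L) (x : Grid d L) :
    plugIn n z x = (((Finset.range n).filter fun k => z k = x).card : ℝ) / n := by
  rw [plugIn, Finset.sum_boole]
  ring

lemma sum_range_eq_sum_plugIn (n : ℕ) (z : ℕ → Grid d L) (f : Grid d L → ℝ) :
    (1 / (n : ℝ)) * ∑ k ∈ Finset.range n, f (z k) = ∑ x, plugIn n z x * f x := by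
  simp only [plugIn, Finset.mul_sum, Finset.sum_mul]
  rw [Finset.sum_comm]
  refine Finset.sum_congr rfl fun k _ => ?_
  simp

lemma kernelEst_eq (r : ℕ) (s : ℝ) (n : ℕ) (z : ℕ → Grid d L) (x : Grid d L) :
    kernelEst r s n z x = (1 - s) * plugIn n z x
      + s / windowCount d r * ∑ y ∈ puncturedWindow r x, plugIn n z y := by
  have h : kernelEst r s n z x = ∑ y, plugIn n z y * weight r s x y := by
    rw [← sum_range_eq_sum_plugIn, kernelEst]
    simp
  have hs : ∀ y, plugIn n z y * weight r s x y = (if y = x then (1 - s) * plugIn n z y else 0)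
      + s / windowCount d r * (if y ≠ x ∧ InWindow r x y then plugIn n z y else 0) := by
    intro y
    unfold weight
    by_cases h1 : y = x
    · simp [h1, mul_comm]
    · by_cases h2 : InWindow r x y
      · simp [h1, h2, mul_comm]
      · simp [h1, h2]
  rw [h, Finset.sum_congr rfl fun y _ => hs y, Finset.sum_add_distrib, ← Finset.mul_sum,
    Finset.sum_ite_eq' Finset.univ x, ← Finset.sum_filter, puncturedWindow]
  simp

lemma exists_smoothPar_le {r : ℕ} (hd : 1 ≤ d) (hr : 1 ≤ r) :
    ∃ K : ℝ, 0 < K ∧ ∀ n, 1 ≤ n → ∀ p : Grid d L → ℝ, IsPmf p →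
      0 ≤ smoothPar r n p ∧ smoothPar r n p ≤ K / n := by
  obtain ⟨a, ha, hap⟩ := exists_pos_le_smoothDefect (L := L) hd hr
  have hm : 0 < min 1 a := lt_min one_pos ha
  refine ⟨2 / min 1 a, by positivity, fun n hn p hp => ?_⟩
  have hn' : (0 : ℝ) < n := by exact_mod_cast hn
  have hge := smoothDen_ge hd hr hn hp (hap p hp)
  have hpos : 0 < min 1 a * (n : ℝ) := by positivity
  rw [smoothPar_eq]
  refine ⟨div_nonneg (smoothNum_nonneg hd hr hp) (hpos.le.trans hge), ?_⟩
  rw [div_div]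
  exact div_le_div₀ zero_le_two (smoothNum_le hd hr hp) hpos hge

/-- Since the relative frequencies have denominator `n`, the numerator of the smoothing parameter
is an integer multiple of `1 / (c n²)`; if it does not vanish, it is at least that. -/
lemma smoothNum_plugIn_ge {r n : ℕ} (hd : 1 ≤ d) (hr : 1 ≤ r) (hn : 1 ≤ n) (z : ℕ → Grid d L)
    (h0 : smoothNum r (plugIn n z) ≠ 0) :
    1 / (windowCount d r * (n : ℝ) ^ 2) ≤ smoothNum r (plugIn n z) := by
  have hc := two_le_windowCount hd hr
  have hn' : (0 : ℝ) < n := by exact_mod_cast hn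
  have hpos : 0 < windowCount d r * (n : ℝ) ^ 2 := by positivity
  let k : Grid d L → ℤ := fun x => (((Finset.range n).filter fun k => z k = x).card : ℤ)
  have hk : ∀ x, plugIn n z x = (k x : ℝ) / n := fun x => by
    rw [plugIn_eq_count]
    simp [k]
  let c : ℤ := (2 * (r : ℤ) + 1) ^ d - 1
  have hcc : windowCount d r = (c : ℝ) := by
    simp [windowCount, c]
  let m : ℤ := c * n ^ 2 - c * ∑ x, k x ^ 2 + ∑ x, ∑ y ∈ puncturedWindow r x, k x * k y
  have hm : smoothNum r (plugIn n z) = (m : ℝ) / (windowCount d r * (n : ℝ) ^ 2) := by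
    have hs1 : ∑ x, plugIn n z x ^ 2 = (∑ x, (k x : ℝ) ^ 2) / (n : ℝ) ^ 2 := by
      rw [Finset.sum_div]
      exact Finset.sum_congr rfl fun x _ => by rw [hk, div_pow]
    have hs2 : ∑ x, ∑ y ∈ puncturedWindow r x, plugIn n z x * plugIn n z y
        = (∑ x, ∑ y ∈ puncturedWindow r x, (k x : ℝ) * k y) / (n : ℝ) ^ 2 := by
      rw [Finset.sum_div]
      refine Finset.sum_congr rfl fun x _ => ?_
      rw [Finset.sum_div]
      exact Finset.sum_congr rfl fun y _ => by rw [hk, hk]; ring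
    have hc0 : windowCount d r ≠ 0 := by positivity
    rw [smoothNum, hs1, hs2]
    simp only [m]
    push_cast
    rw [← hcc]
    field_simp
  rw [hm] at h0 ⊢
  have hnn : 0 ≤ (m : ℝ) / (windowCount d r * (n : ℝ) ^ 2) :=
    hm ▸ smoothNum_nonneg hd hr (isPmf_plugIn hn z)
  have hm0 : 0 < m := by
    have h1 : 0 < (m : ℝ) / (windowCount d r * (n : ℝ) ^ 2) := lt_of_le_of_ne hnn (Ne.symm h0)
    have h2 : (0 : ℝ) < m := by
      by_contra hle
      exact absurd h1 (not_lt.2 (div_nonpos_of_nonpos_of_nonneg (not_lt.1 hle) hpos.le))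
    exact_mod_cast h2
  exact div_le_div_of_nonneg_right (by exact_mod_cast hm0) hpos.le

/-- The smoothing parameter is `O(1/n)` for every sample, so the kernel estimator differs from
the relative frequencies by a deterministic `O(1/n)`. -/
lemma exists_abs_adaptiveEst_sub_le {r : ℕ} (hd : 1 ≤ d) (hr : 1 ≤ r) :
    ∃ K : ℝ, 0 < K ∧ ∀ n, 1 ≤ n → ∀ (z : ℕ → Grid d L) x,
      |adaptiveEst r n z x - plugIn n z x| ≤ K / n := by
  obtain ⟨K, hK, h⟩ := exists_smoothPar_le (L := L) hd hr
  have hc := two_le_windowCount hd hr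
  refine ⟨K, hK, fun n hn z x => ?_⟩
  have hp := isPmf_plugIn hn z
  obtain ⟨hs0, hs1⟩ := h n hn _ hp
  rw [adaptiveEst, kernelEst_eq]
  set s := smoothPar r n (plugIn n z)
  set S := ∑ y ∈ puncturedWindow r x, plugIn n z y
  have hS0 : 0 ≤ S / windowCount d r := div_nonneg (hp.sum_window_nonneg r x) (by linarith)
  have hS1 : S / windowCount d r ≤ 1 := by
    rw [div_le_one (by linarith)]
    linarith [hp.sum_window_le_one r x]
  have heq : (1 - s) * plugIn n z x + s / windowCount d r * S - plugIn n z x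
      = s * (S / windowCount d r - plugIn n z x) := by ring
  rw [heq, abs_mul, abs_of_nonneg hs0]
  refine (mul_le_of_le_one_right hs0 ?_).trans hs1
  rw [abs_le]
  constructor <;> linarith [hp.1 x, hp.le_one x]

/-- A value of the kernel estimator that does not vanish is at least of order `n⁻⁴`. -/
lemma exists_le_adaptiveEst {r : ℕ} (hd : 1 ≤ d) (hr : 1 ≤ r) :
    ∃ k : ℝ, 0 < k ∧ ∃ n₀ : ℕ, 1 ≤ n₀ ∧ ∀ n, n₀ ≤ n → ∀ (z : ℕ → Grid d L) x,
      adaptiveEst r n z x ≠ 0 → k / (n : ℝ) ^ 4 ≤ adaptiveEst r n z x := by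
  obtain ⟨K, hK, h⟩ := exists_smoothPar_le (L := L) hd hr
  have hc := two_le_windowCount hd hr
  set c := windowCount d r with hcdef
  set g : ℝ := 1 + 2 * Fintype.card (Grid d L) with hg
  have hg0 : 0 < g := by positivity
  have hc0 : 0 < c := by linarith
  -- for `n ≥ 2 K` the smoothing parameter is at most `1 / 2`
  refine ⟨min (1 / 2) (1 / (c ^ 2 * g)), lt_min (by norm_num) (by positivity),
    max 1 ⌈2 * K⌉₊, le_max_left _ _, fun n hn z x hne => ?_⟩
  have hn1 : 1 ≤ n := (le_max_left _ _).trans hn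
  have hn2 : 2 * K ≤ n := (Nat.le_ceil _).trans (by exact_mod_cast (le_max_right _ _).trans hn)
  have hn1' : (1 : ℝ) ≤ n := by exact_mod_cast hn1
  have hn' : (0 : ℝ) < n := by linarith
  have hp := isPmf_plugIn hn1 z
  obtain ⟨hs0, hs1⟩ := h n hn1 _ hp
  have hs2 : smoothPar r n (plugIn n z) ≤ 1 / 2 := by
    refine hs1.trans ?_
    rw [div_le_div_iff₀ hn' two_pos]
    linarith
  rw [adaptiveEst, kernelEst_eq] at hne ⊢
  set s := smoothPar r n (plugIn n z) with hs
  set S := ∑ y ∈ puncturedWindow r x, plugIn n z y with hSdef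
  have hS0 : 0 ≤ S := hp.sum_window_nonneg r x
  have hge : ∀ y, plugIn n z y ≠ 0 → 1 / (n : ℝ) ≤ plugIn n z y := fun y hy => by
    rw [plugIn_eq_count] at hy ⊢
    refine div_le_div_of_nonneg_right ?_ hn'.le
    have : ((Finset.range n).filter fun k => z k = y).card ≠ 0 := fun h0 => hy (by simp [h0])
    exact_mod_cast Nat.one_le_iff_ne_zero.2 this
  by_cases hx : plugIn n z x = 0
  -- an unobserved point gets its mass from the window, through a smoothing parameter of order
  -- at least `n⁻³` and a window frequency of at least `1 / n`
  · rw [hx, mul_zero, zero_add] at hne ⊢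
    have hsne : s ≠ 0 := fun h0 => hne (by simp [h0])
    have hSne : S ≠ 0 := fun h0 => hne (by simp [h0])
    obtain ⟨y, hy, hy0⟩ := Finset.exists_ne_zero_of_sum_ne_zero hSne
    have hS1 : 1 / (n : ℝ) ≤ S :=
      (hge y hy0).trans (Finset.single_le_sum (fun y _ => hp.1 y) hy)
    have hnum : smoothNum r (plugIn n z) ≠ 0 := fun h0 => hsne (by simp [hs, smoothPar_eq, h0])
    have hden : 0 < smoothDen r n (plugIn n z) := by
      by_contra hle
      exact hsne (le_antisymm (div_nonpos_of_nonneg_of_nonpos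
        (smoothNum_nonneg hd hr hp) (not_lt.1 hle)) hs0)
    have hslow : 1 / (c * (n : ℝ) ^ 2) / (g * n) ≤ s := by
      rw [hs, smoothPar_eq]
      exact div_le_div₀ (smoothNum_nonneg hd hr hp) (smoothNum_plugIn_ge hd hr hn1 z hnum) hden
        (smoothDen_le hd hr hn1 hp)
    calc min (1 / 2) (1 / (c ^ 2 * g)) / (n : ℝ) ^ 4 ≤ 1 / (c ^ 2 * g) / (n : ℝ) ^ 4 :=
          div_le_div_of_nonneg_right (min_le_right _ _) (by positivity)
      _ = 1 / (c * (n : ℝ) ^ 2) / (g * n) / c * (1 / n) := by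
          field_simp
      _ ≤ s / c * S := mul_le_mul (div_le_div_of_nonneg_right hslow hc0.le) hS1 (by positivity)
          (by positivity)
  · calc min (1 / 2) (1 / (c ^ 2 * g)) / (n : ℝ) ^ 4 ≤ 1 / 2 / (n : ℝ) ^ 1 :=
          div_le_div₀ (by norm_num) (min_le_left _ _) (by positivity)
            (pow_le_pow_right₀ hn1' (by norm_num))
      _ = 1 / 2 * (1 / n) := by ring
      _ ≤ (1 - s) * plugIn n z x := mul_le_mul (by linarith) (hge x hx) (by positivity)
          (by linarith)
      _ ≤ _ := le_add_of_nonneg_right (by positivity)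

/-! ### Deterministic error bounds -/

lemma tendsto_sizeM {μ : ℝ} (hμ₀ : 0 < μ) : Tendsto (sizeM μ) atTop atTop :=
  tendsto_nat_floor_atTop.comp (tendsto_natCast_atTop_atTop.const_mul_atTop hμ₀)

lemma eventually_sizeM_ge {μ : ℝ} (hμ₀ : 0 < μ) :
    ∀ᶠ Γ : ℕ in atTop, μ / 2 * Γ ≤ (sizeM μ Γ : ℝ) := by
  filter_upwards [eventually_ge_atTop ⌈2 / μ⌉₊] with Γ hΓ
  have h1 : 2 / μ ≤ (Γ : ℝ) := (Nat.le_ceil _).trans (by exact_mod_cast hΓ)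
  rw [div_le_iff₀ hμ₀] at h1
  have h2 : μ * Γ < (sizeM μ Γ : ℝ) + 1 := Nat.lt_floor_add_one _
  linarith

lemma sizeM_le {μ : ℝ} (hμ₀ : 0 < μ) (hμ₁ : μ < 1) (Γ : ℕ) : sizeM μ Γ ≤ Γ := by
  have h : (sizeM μ Γ : ℝ) ≤ μ * Γ := Nat.floor_le (by positivity)
  have h' : μ * (Γ : ℝ) ≤ 1 * Γ := mul_le_mul_of_nonneg_right hμ₁.le (by positivity)
  exact_mod_cast (h.trans h').trans_eq (one_mul _)

lemma sizeN_ge {μ : ℝ} (hμ₀ : 0 < μ) (hμ₁ : μ < 1) (Γ : ℕ) :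
    (1 - μ) * Γ ≤ (sizeN μ Γ : ℝ) := by
  have h : (sizeM μ Γ : ℝ) ≤ μ * Γ := Nat.floor_le (by positivity)
  rw [sizeN, Nat.cast_sub (sizeM_le hμ₀ hμ₁ Γ)]
  linarith

/-- The lower bound `e^ϖ ≤ F_ϖ(P ‖ Q)` comes from the tangent of the exponential at `ϖ` and
`∑ p² / q - 1 = ∑ (p - q)² / q ≥ 0`. -/
lemma exp_le_miF {ϖ : ℝ} (hϖ : 0 < ϖ) {p q : Grid d L → ℝ} (hp : IsPmf p) (hq : IsPmf q)
    (hq_pos : ∀ x, 0 < q x) : Real.exp ϖ ≤ miF ϖ p q := by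
  have h : ∀ x, Real.exp ϖ * (p x + ϖ * (p x - q x)) ≤ p x * Real.exp (ϖ * (p x / q x)) := by
    intro x
    have h1 : ϖ * (p x / q x - 1) + 1 ≤ Real.exp (ϖ * (p x / q x - 1)) := Real.add_one_le_exp _
    have h2 : Real.exp (ϖ * (p x / q x)) = Real.exp ϖ * Real.exp (ϖ * (p x / q x - 1)) := by
      rw [← Real.exp_add]
      ring_nf
    have h3 : p x - q x ≤ p x * (p x / q x - 1) := by
      have : p x * (p x / q x - 1) - (p x - q x) = (p x - q x) ^ 2 / q x := by
        field_simp [(hq_pos x).ne']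
      have := div_nonneg (sq_nonneg (p x - q x)) (hq_pos x).le
      linarith
    rw [h2]
    calc _ ≤ Real.exp ϖ * (p x * (ϖ * (p x / q x - 1) + 1)) := by
          refine mul_le_mul_of_nonneg_left ?_ (Real.exp_pos _).le
          nlinarith [mul_le_mul_of_nonneg_left h3 hϖ.le]
      _ ≤ Real.exp ϖ * (p x * Real.exp (ϖ * (p x / q x - 1))) :=
          mul_le_mul_of_nonneg_left (mul_le_mul_of_nonneg_left h1 (hp.1 x)) (Real.exp_pos _).le
      _ = _ := by ring
  calc Real.exp ϖ = ∑ x, Real.exp ϖ * (p x + ϖ * (p x - q x)) := by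
        rw [← Finset.mul_sum, Finset.sum_add_distrib, ← Finset.mul_sum, Finset.sum_sub_distrib,
          hp.2, hq.2]
        ring
    _ ≤ _ := Finset.sum_le_sum fun x _ => h x

/-- The functional `(a, b, c) ↦ ∑ a e^{ϖ b / c}`. It takes the value `F_ϖ(P ‖ Q)` at `(p, p, q)`,
and the estimators are its values at estimates of this triple. -/
noncomputable def expFunctional (ϖ : ℝ)
    (v : (Grid d L → ℝ) × (Grid d L → ℝ) × (Grid d L → ℝ)) : ℝ :=
  ∑ x, v.1 x * Real.exp (ϖ * (v.2.1 x / v.2.2 x))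

lemma differentiableAt_expFunctional (ϖ : ℝ) (p : Grid d L → ℝ) {q : Grid d L → ℝ}
    (hq_pos : ∀ x, 0 < q x) : DifferentiableAt ℝ (expFunctional ϖ) (p, p, q) := by
  have h1 : ∀ x, DifferentiableAt ℝ
      (fun v : (Grid d L → ℝ) × (Grid d L → ℝ) × (Grid d L → ℝ) => v.1 x) (p, p, q) :=
    fun x => by fun_prop
  have h2 : ∀ x, DifferentiableAt ℝ
      (fun v : (Grid d L → ℝ) × (Grid d L → ℝ) × (Grid d L → ℝ) => v.2.1 x) (p, p, q) :=
    fun x => by fun_prop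
  have h3 : ∀ x, DifferentiableAt ℝ
      (fun v : (Grid d L → ℝ) × (Grid d L → ℝ) × (Grid d L → ℝ) => v.2.2 x) (p, p, q) :=
    fun x => by fun_prop
  unfold expFunctional
  refine DifferentiableAt.fun_sum fun x _ => (h1 x).mul ?_
  have h4 := (h2 x).fun_mul ((h3 x).fun_inv (hq_pos x).ne')
  exact (h4.const_mul ϖ).exp

lemma estF_eq (ϖ μ : ℝ) (Γ r : ℕ) (xs ys : ℕ → Grid d L) :
    estF ϖ μ Γ r xs ys
      = expFunctional ϖ (plugIn (sizeN μ Γ) xs, estP μ Γ r xs, estQ μ Γ r ys) :=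
  sum_range_eq_sum_plugIn _ _ fun x => Real.exp (ϖ * (estP μ Γ r xs x / estQ μ Γ r ys x))

/-- The squared distance of the three vectors of relative frequencies from `(p, p, q)`. -/
noncomputable def sampleDev (p q : Grid d L → ℝ) (μ : ℝ) (Γ : ℕ) (xs ys : ℕ → Grid d L) : ℝ :=
  ∑ x, ((plugIn (sizeN μ Γ) xs x - p x) ^ 2
    + (plugIn (sizeM μ Γ) (fun k => xs (sizeN μ Γ + k)) x - p x) ^ 2
    + (plugIn (sizeM μ Γ) ys x - q x) ^ 2)

lemma sampleDev_nonneg (p q : Grid d L → ℝ) (μ : ℝ) (Γ : ℕ) (xs ys : ℕ → Grid d L) :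
    0 ≤ sampleDev p q μ Γ xs ys :=
  Finset.sum_nonneg fun _ _ => by positivity

lemma le_sampleDev (p q : Grid d L → ℝ) (μ : ℝ) (Γ : ℕ) (xs ys : ℕ → Grid d L) (x : Grid d L) :
    (plugIn (sizeN μ Γ) xs x - p x) ^ 2
    + (plugIn (sizeM μ Γ) (fun k => xs (sizeN μ Γ + k)) x - p x) ^ 2
    + (plugIn (sizeM μ Γ) ys x - q x) ^ 2 ≤ sampleDev p q μ Γ xs ys :=
  Finset.single_le_sum (f := fun x => (plugIn (sizeN μ Γ) xs x - p x) ^ 2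
    + (plugIn (sizeM μ Γ) (fun k => xs (sizeN μ Γ + k)) x - p x) ^ 2
    + (plugIn (sizeM μ Γ) ys x - q x) ^ 2) (fun _ _ => by positivity) (Finset.mem_univ x)

lemma norm_estimates_sub_le (p q : Grid d L → ℝ) {μ K : ℝ} {Γ r : ℕ} (hK : 0 ≤ K)
    (xs ys : ℕ → Grid d L)
    (hr : ∀ (z : ℕ → Grid d L) x,
      |adaptiveEst r (sizeM μ Γ) z x - plugIn (sizeM μ Γ) z x| ≤ K) :
    ‖(plugIn (sizeN μ Γ) xs, estP μ Γ r xs, estQ μ Γ r ys) - (p, p, q)‖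
      ≤ √(sampleDev p q μ Γ xs ys) + K := by
  have h0 : 0 ≤ √(sampleDev p q μ Γ xs ys) + K := by positivity
  have hle := le_sampleDev p q μ Γ xs ys
  have hP := hr fun k => xs (sizeN μ Γ + k)
  have hQ := hr ys
  simp only [Prod.mk_sub_mk, norm_prod_le_iff, pi_norm_le_iff_of_nonneg h0, Pi.sub_apply,
    Real.norm_eq_abs]
  refine ⟨fun x => ?_, fun x => ?_, fun x => ?_⟩
  · refine (Real.abs_le_sqrt ?_).trans (le_add_of_nonneg_right hK)
    exact le_trans (by nlinarith) (hle x)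
  · refine (abs_sub_le _ (plugIn (sizeM μ Γ) (fun k => xs (sizeN μ Γ + k)) x) _).trans ?_
    rw [add_comm]
    refine add_le_add (Real.abs_le_sqrt ?_) (hP x)
    exact le_trans (by nlinarith) (hle x)
  · refine (abs_sub_le _ (plugIn (sizeM μ Γ) ys x) _).trans ?_
    rw [add_comm]
    refine add_le_add (Real.abs_le_sqrt ?_) (hQ x)
    exact le_trans (by nlinarith) (hle x)

lemma abs_log_sub_log_le {η a b : ℝ} (hη : 0 < η) (ha : η ≤ a) (hb : η ≤ b) :
    |Real.log a - Real.log b| ≤ |a - b| / η := by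
  have key : ∀ a b : ℝ, η ≤ a → η ≤ b → Real.log a - Real.log b ≤ |a - b| / η := by
    intro a b ha hb
    have hb' : 0 < b := hη.trans_le hb
    rw [← Real.log_div (hη.trans_le ha).ne' hb'.ne']
    calc Real.log (a / b) ≤ a / b - 1 := Real.log_le_sub_one_of_pos (div_pos (hη.trans_le ha) hb')
      _ = (a - b) / b := by field_simp
      _ ≤ |a - b| / b := div_le_div_of_nonneg_right (le_abs_self _) hb'.le
      _ ≤ |a - b| / η := div_le_div_of_nonneg_left (abs_nonneg _) hη hb
  rw [abs_le]
  constructor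
  · have := key b a hb ha
    rw [abs_sub_comm] at this
    linarith
  · exact key a b ha hb

/-- Samples whose relative frequencies are close to `(p, p, q)` are not degenerate, and on them
the squared error is at most of the order of `sampleDev` and `Γ⁻²`, uniformly over bounded weights
summing to one. -/
lemma exists_sq_error_le {T : ℕ} (hd : 1 ≤ d) {r : Fin T → ℕ} (hr : ∀ l, 1 ≤ r l)
    {ϖ μ η B : ℝ} (κ : ℝ) (hϖ : 0 < ϖ) (hμ₀ : 0 < μ) (hη₀ : 0 < η) (hη₁ : η < Real.exp ϖ)
    (hB : 0 ≤ B) {p q : Grid d L → ℝ} (hp : IsPmf p) (hq : IsPmf q) (hq_pos : ∀ x, 0 < q x) :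
    ∃ C δ : ℝ, 0 < δ ∧ ∀ᶠ Γ : ℕ in atTop, ∀ w : Fin T → ℝ, ∑ l, w l = 1 → (∀ l, |w l| ≤ B) →
      ∀ xs ys : ℕ → Grid d L, sampleDev p q μ Γ xs ys ≤ δ →
        ¬ Degenerate ϖ μ η r w Γ xs ys ∧
        (estD ϖ μ η κ r w Γ xs ys - miDivergence ϖ p q) ^ 2
          ≤ C * (sampleDev p q μ Γ xs ys + ((Γ : ℝ) ^ 2)⁻¹) := by
  choose K hK hKr using fun l => exists_abs_adaptiveEst_sub_le (L := L) hd (hr l)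
  obtain ⟨A, hA0, hA⟩ := (differentiableAt_expFunctional ϖ p hq_pos).isBigO_sub.exists_nonneg
  have hq_ev : ∀ᶠ v : (Grid d L → ℝ) × (Grid d L → ℝ) × (Grid d L → ℝ) in nhds (p, p, q),
      ∀ x, v.2.2 x ≠ 0 := by
    rw [eventually_all]
    intro x
    have hc : ContinuousAt
        (fun v : (Grid d L → ℝ) × (Grid d L → ℝ) × (Grid d L → ℝ) => v.2.2 x) (p, p, q) := by
      fun_prop
    exact hc.eventually_ne (hq_pos x).ne'
  obtain ⟨ρ, hρ, hball⟩ := Metric.eventually_nhds_iff.1 (hA.bound.and hq_ev)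
  have hF : η < miF ϖ p q := hη₁.trans_le (exp_le_miF hϖ hp hq hq_pos)
  -- the radius within which the ensemble stays above the threshold as well
  set A' : ℝ := T * (B * A) with hA'
  have hA'0 : 0 ≤ A' := by positivity
  set ρ' : ℝ := min ρ ((miF ϖ p q - η) / (A' + 1)) with hρ'
  have hρ'0 : 0 < ρ' := lt_min hρ (div_pos (by linarith) (by linarith))
  set K' : ℝ := (∑ l, K l) * (2 / μ) with hK'
  have hKsum : 0 ≤ ∑ l, K l := Finset.sum_nonneg fun l _ => (hK l).le
  have hK'0 : 0 ≤ K' := by positivity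
  have hsmall : ∀ᶠ Γ : ℕ in atTop, K' * ((Γ : ℝ))⁻¹ < ρ' / 2 := by
    have ht : Tendsto (fun Γ : ℕ => K' * ((Γ : ℝ))⁻¹) atTop (nhds (K' * 0)) :=
      (tendsto_inv_atTop_nhds_zero_nat (𝕜 := ℝ)).const_mul K'
    rw [mul_zero] at ht
    exact ht.eventually_lt_const (by positivity)
  refine ⟨(A' / η) ^ 2 * (2 * (1 + K' ^ 2)), (ρ' / 4) ^ 2, by positivity, ?_⟩
  filter_upwards [hsmall, eventually_sizeM_ge hμ₀, eventually_ge_atTop 1] with Γ hΓ hM hΓ1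
  intro w hw1 hwB xs ys hdev
  have hΓ0 : (0 : ℝ) < Γ := by exact_mod_cast hΓ1
  have hM0 : 0 < (sizeM μ Γ : ℝ) := lt_of_lt_of_le (by positivity) hM
  have hM1 : 1 ≤ sizeM μ Γ := by
    have : 0 < sizeM μ Γ := by exact_mod_cast hM0
    omega
  set V := sampleDev p q μ Γ xs ys with hV
  have hV0 : 0 ≤ V := sampleDev_nonneg _ _ _ _ _ _
  have hsqrt : √V ≤ ρ' / 4 := by
    rw [Real.sqrt_le_left (by positivity)]
    exact hdev
  set E : ℝ := √V + K' * ((Γ : ℝ))⁻¹ with hE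
  have hE0 : 0 ≤ E := by positivity
  have hEρ : E < ρ' := by linarith
  have hnorm : ∀ l, ‖(plugIn (sizeN μ Γ) xs, estP μ Γ (r l) xs, estQ μ Γ (r l) ys) - (p, p, q)‖
      ≤ E := fun l => by
    refine norm_estimates_sub_le p q (by positivity) xs ys fun z x => ?_
    refine (hKr l _ hM1 z x).trans ?_
    calc K l / sizeM μ Γ ≤ (∑ l, K l) / (μ / 2 * Γ) :=
          div_le_div₀ hKsum (Finset.single_le_sum (f := K) (fun l _ => (hK l).le)
            (Finset.mem_univ l)) (by positivity) hM
      _ = K' * ((Γ : ℝ))⁻¹ := by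
          rw [hK']
          field_simp
  have hl : ∀ l, |estF ϖ μ Γ (r l) xs ys - miF ϖ p q| ≤ A * E ∧
      ∀ x, estQ μ Γ (r l) ys x ≠ 0 := fun l => by
    obtain ⟨h1, h2⟩ := hball (y := (plugIn (sizeN μ Γ) xs, estP μ Γ (r l) xs, estQ μ Γ (r l) ys))
      (by
        rw [dist_eq_norm]
        exact (hnorm l).trans_lt (hEρ.trans_le (min_le_left _ _)))
    refine ⟨?_, h2⟩
    rw [estF_eq]
    exact h1.trans (mul_le_mul_of_nonneg_left (hnorm l) hA0)
  have hens : |ensembleF ϖ μ r w Γ xs ys - miF ϖ p q| ≤ A' * E := by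
    have heq : ensembleF ϖ μ r w Γ xs ys - miF ϖ p q
        = ∑ l, w l * (estF ϖ μ Γ (r l) xs ys - miF ϖ p q) := by
      simp only [mul_sub, Finset.sum_sub_distrib, ← Finset.sum_mul, hw1, one_mul, ensembleF]
    rw [heq]
    calc _ ≤ ∑ l, |w l * (estF ϖ μ Γ (r l) xs ys - miF ϖ p q)| := Finset.abs_sum_le_sum_abs _ _
      _ ≤ ∑ _l : Fin T, B * (A * E) := by
          refine Finset.sum_le_sum fun l _ => ?_
          rw [abs_mul]
          exact mul_le_mul (hwB l) (hl l).1 (abs_nonneg _) hB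
      _ = A' * E := by
          rw [hA']
          simp
          ring
  have hA'E : A' * E ≤ miF ϖ p q - η := by
    have h1 : E ≤ (miF ϖ p q - η) / (A' + 1) := hEρ.le.trans (min_le_right _ _)
    rw [le_div_iff₀ (by linarith)] at h1
    nlinarith
  have hge : η ≤ ensembleF ϖ μ r w Γ xs ys := by
    have := (abs_le.1 hens).1
    linarith
  have hdeg : ¬ Degenerate ϖ μ η r w Γ xs ys := by
    rintro (⟨l, -, i, -, h0⟩ | hlt)
    · exact (hl l).2 _ h0
    · exact absurd hlt (not_lt.2 hge)
  refine ⟨hdeg, ?_⟩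
  have hlog : |estD ϖ μ η κ r w Γ xs ys - miDivergence ϖ p q| ≤ A' / η * E := by
    rw [estD, if_neg hdeg, miDivergence, sub_sub_sub_cancel_right]
    refine (abs_log_sub_log_le hη₀ hge hF.le).trans ?_
    calc _ ≤ A' * E / η := div_le_div_of_nonneg_right hens hη₀.le
      _ = _ := by ring
  have hE2 : E ^ 2 ≤ 2 * (1 + K' ^ 2) * (V + ((Γ : ℝ) ^ 2)⁻¹) := by
    have h1 : E ^ 2 ≤ 2 * (√V ^ 2 + (K' * ((Γ : ℝ))⁻¹) ^ 2) := add_sq_le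
    rw [Real.sq_sqrt hV0, mul_pow, inv_pow] at h1
    have h2 : 0 ≤ ((Γ : ℝ) ^ 2)⁻¹ := by positivity
    nlinarith [mul_nonneg (sq_nonneg K') hV0]
  calc _ = |estD ϖ μ η κ r w Γ xs ys - miDivergence ϖ p q| ^ 2 := (sq_abs _).symm
    _ ≤ (A' / η * E) ^ 2 := pow_le_pow_left₀ (abs_nonneg _) hlog 2
    _ = (A' / η) ^ 2 * E ^ 2 := mul_pow _ _ _
    _ ≤ (A' / η) ^ 2 * (2 * (1 + K' ^ 2) * (V + ((Γ : ℝ) ^ 2)⁻¹)) :=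
        mul_le_mul_of_nonneg_left hE2 (sq_nonneg _)
    _ = _ := by ring

/-- On every sample the error grows at most polynomially: the estimate `q̃` in the denominator is
either `0`, which makes the sample degenerate, or at least of order `Γ⁻⁴`. -/
lemma exists_abs_error_le {T : ℕ} (hT : 1 ≤ T) (hd : 1 ≤ d) {r : Fin T → ℕ} (hr : ∀ l, 1 ≤ r l)
    {ϖ μ η B : ℝ} (κ D : ℝ) (hϖ : 0 < ϖ) (hμ₀ : 0 < μ) (hμ₁ : μ < 1) (hη₀ : 0 < η)
    (hB : 1 ≤ B) :
    ∃ C : ℝ, ∀ᶠ Γ : ℕ in atTop, ∀ w : Fin T → ℝ, (∀ l, |w l| ≤ B) →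
      ∀ xs ys : ℕ → Grid d L, |estD ϖ μ η κ r w Γ xs ys - D| ≤ C * (Γ : ℝ) ^ 4 := by
  choose K hK hKr using fun l => exists_abs_adaptiveEst_sub_le (L := L) hd (hr l)
  choose k hk n₀ hn₀ hkr using fun l => exists_le_adaptiveEst (L := L) hd (hr l)
  set G : ℝ := ∑ l, (1 + K l) * (1 / k l) with hG
  have hGl : ∀ l, (1 + K l) * (1 / k l) ≤ G := fun l =>
    Finset.single_le_sum (f := fun l => (1 + K l) * (1 / k l))
      (fun l _ => by have := hK l; have := hk l; positivity) (Finset.mem_univ l)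
  have hG0 : 0 ≤ G := Finset.sum_nonneg fun l _ => by have := hK l; have := hk l; positivity
  have hT' : (1 : ℝ) ≤ T := by exact_mod_cast hT
  have hTB : 1 ≤ T * B := by nlinarith
  refine ⟨|κ| + |D| + |Real.log η| + Real.log (T * B) + ϖ * G + ϖ, ?_⟩
  have hlarge : ∀ᶠ Γ : ℕ in atTop, ∀ l, n₀ l ≤ sizeM μ Γ :=
    eventually_all.2 fun l => (tendsto_sizeM hμ₀).eventually_ge_atTop (n₀ l)
  filter_upwards [hlarge, eventually_ge_atTop 1] with Γ hΓ hΓ1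
  intro w hwB xs ys
  have hΓ4 : (1 : ℝ) ≤ (Γ : ℝ) ^ 4 := one_le_pow₀ (by exact_mod_cast hΓ1)
  have hMΓ : (sizeM μ Γ : ℝ) ≤ Γ := by exact_mod_cast sizeM_le hμ₀ hμ₁ Γ
  have hlogTB : 0 ≤ Real.log (T * B) := Real.log_nonneg hTB
  have hN0 : (0 : ℝ) < sizeN μ Γ := by
    refine lt_of_lt_of_le ?_ (sizeN_ge hμ₀ hμ₁ Γ)
    have : (0 : ℝ) < Γ := by exact_mod_cast hΓ1
    exact mul_pos (by linarith) this
  by_cases hdeg : Degenerate ϖ μ η r w Γ xs ys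
  · rw [estD, if_pos hdeg]
    refine (abs_sub _ _).trans ?_
    have h0 : 0 ≤ |Real.log η| + Real.log (T * B) + ϖ * G + ϖ := by positivity
    have h1 : 0 ≤ |κ| + |D| := by positivity
    nlinarith
  · rw [estD, if_neg hdeg]
    unfold Degenerate at hdeg
    push Not at hdeg
    obtain ⟨hne, hge⟩ := hdeg
    have hlow : Real.log η ≤ Real.log (ensembleF ϖ μ r w Γ xs ys) := Real.log_le_log hη₀ hge
    have hterm : ∀ l, w l ≠ 0 → ∀ i < sizeN μ Γ,
        Real.exp (ϖ * (estP μ Γ (r l) xs (xs i) / estQ μ Γ (r l) ys (xs i)))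
          ≤ Real.exp (ϖ * (G * (Γ : ℝ) ^ 4)) := by
      intro l hl i hi
      refine Real.exp_le_exp.2 (mul_le_mul_of_nonneg_left ?_ hϖ.le)
      have hM1 : 1 ≤ sizeM μ Γ := (hn₀ l).trans (hΓ l)
      have hM1' : (1 : ℝ) ≤ sizeM μ Γ := by exact_mod_cast hM1
      have hM0 : (0 : ℝ) < sizeM μ Γ := by linarith
      have hkl := hk l
      have hKl := hK l
      have hQ : k l / (sizeM μ Γ : ℝ) ^ 4 ≤ estQ μ Γ (r l) ys (xs i) :=
        hkr l _ (hΓ l) ys (xs i) (hne l hl i hi)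
      have hQ0 : 0 < k l / (sizeM μ Γ : ℝ) ^ 4 := by positivity
      have hP : estP μ Γ (r l) xs (xs i) ≤ 1 + K l := by
        have h1 := (abs_le.1 (hKr l _ hM1 (fun k => xs (sizeN μ Γ + k)) (xs i))).2
        have h2 := (isPmf_plugIn hM1 fun k => xs (sizeN μ Γ + k)).le_one (xs i)
        have h3 : K l / sizeM μ Γ ≤ K l := div_le_self hKl.le hM1'
        unfold estP
        linarith
      calc _ ≤ (1 + K l) / (k l / (sizeM μ Γ : ℝ) ^ 4) :=
            div_le_div₀ (by positivity) hP hQ0 hQ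
        _ = (1 + K l) * (1 / k l) * (sizeM μ Γ : ℝ) ^ 4 := by
            field_simp
        _ ≤ G * (Γ : ℝ) ^ 4 := mul_le_mul (hGl l) (pow_le_pow_left₀ hM0.le hMΓ 4)
            (by positivity) hG0
    have hF : ∀ l, w l ≠ 0 → estF ϖ μ Γ (r l) xs ys ≤ Real.exp (ϖ * (G * (Γ : ℝ) ^ 4)) := by
      intro l hl
      rw [estF, one_div, inv_mul_le_iff₀ hN0]
      calc _ ≤ ∑ _i ∈ Finset.range (sizeN μ Γ), Real.exp (ϖ * (G * (Γ : ℝ) ^ 4)) :=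
            Finset.sum_le_sum fun i hi => hterm l hl i (Finset.mem_range.1 hi)
        _ = _ := by simp
    have hF0 : ∀ l, 0 ≤ estF ϖ μ Γ (r l) xs ys := fun l =>
      mul_nonneg (by positivity) (Finset.sum_nonneg fun i _ => (Real.exp_pos _).le)
    have hens : ensembleF ϖ μ r w Γ xs ys ≤ T * B * Real.exp (ϖ * (G * (Γ : ℝ) ^ 4)) := by
      calc ensembleF ϖ μ r w Γ xs ys ≤ ∑ _l : Fin T, B * Real.exp (ϖ * (G * (Γ : ℝ) ^ 4)) := by
            refine Finset.sum_le_sum fun l _ => ?_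
            by_cases hl : w l = 0
            -- windows of weight zero may have vanishing denominators, but do not contribute
            · rw [hl, zero_mul]
              positivity
            · exact mul_le_mul ((le_abs_self _).trans (hwB l)) (hF l hl) (hF0 l) (by linarith)
        _ = _ := by
            simp
            ring
    have hup : Real.log (ensembleF ϖ μ r w Γ xs ys)
        ≤ Real.log (T * B) + ϖ * (G * (Γ : ℝ) ^ 4) := by
      refine (Real.log_le_log (hη₀.trans_le hge) hens).trans_eq ?_
      rw [Real.log_mul (by linarith) (Real.exp_pos _).ne', Real.log_exp]
    have h1 : 0 ≤ |κ| + |D| + |Real.log η| + Real.log (T * B) + ϖ := by positivity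
    have h2 : |κ| + |D| + |Real.log η| + Real.log (T * B) + ϖ
        ≤ (|κ| + |D| + |Real.log η| + Real.log (T * B) + ϖ) * (Γ : ℝ) ^ 4 :=
      le_mul_of_one_le_right h1 hΓ4
    have h3 : 0 ≤ ϖ * (G * (Γ : ℝ) ^ 4) := by positivity
    rw [abs_le]
    constructor <;>
      linarith [neg_abs_le (Real.log η), le_abs_self D, neg_abs_le D, abs_nonneg κ,
        abs_nonneg (Real.log η)]

/-! ### Fluctuations of the relative frequencies -/

variable {Ω : Type*} [MeasurableSpace Ω] {Pr : Measure Ω}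

/-- The centred indicator of the event `Z = x`, where `m` is the probability of the event. -/
noncomputable def centredHit (x : Grid d L) (m : ℝ) (z : Grid d L) : ℝ :=
  (if z = x then 1 else 0) - m

lemma plugIn_sub_eq {n : ℕ} (hn : 1 ≤ n) (z : ℕ → Grid d L) (x : Grid d L) (m : ℝ) :
    plugIn n z x - m = (1 / (n : ℝ)) * ∑ k ∈ Finset.range n, centredHit x m (z k) := by
  have hn' : (n : ℝ) ≠ 0 := by positivity
  simp only [plugIn, centredHit, Finset.sum_sub_distrib, Finset.sum_const, Finset.card_range,
    nsmul_eq_mul]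
  field_simp

lemma integral_hit {Z : Ω → Grid d L} (hZ : Measurable Z) {x : Grid d L} {m : ℝ}
    (hm : Pr.real {ω | Z ω = x} = m) : ∫ ω, (if Z ω = x then (1 : ℝ) else 0) ∂Pr = m := by
  have hs : MeasurableSet {ω | Z ω = x} := hZ (measurableSet_singleton x)
  have h : (fun ω => if Z ω = x then (1 : ℝ) else 0) = {ω | Z ω = x}.indicator fun _ => 1 := by
    ext ω
    simp [Set.indicator]
  rw [h, integral_indicator_const _ hs, hm]
  simp

lemma iIndepFun_centredHit {Z : ℕ → Ω → Grid d L} (hi : iIndepFun Z Pr) (x : Grid d L) (m : ℝ) :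
    iIndepFun (fun k ω => centredHit x m (Z k ω)) Pr :=
  hi.comp (fun _ => centredHit x m) fun _ => measurable_of_finite _

variable [IsProbabilityMeasure Pr]

lemma hasSubgaussianMGF_centredHit {Z : Ω → Grid d L} (hZ : Measurable Z) {x : Grid d L} {m : ℝ}
    (hm : Pr.real {ω | Z ω = x} = m) :
    HasSubgaussianMGF (fun ω => centredHit x m (Z ω)) ((‖(1 : ℝ) - 0‖₊ / 2) ^ 2) Pr := by
  have hmeas : Measurable fun ω => if Z ω = x then (1 : ℝ) else 0 :=
    (measurable_of_finite fun z : Grid d L => if z = x then (1 : ℝ) else 0).comp hZ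
  have h := hasSubgaussianMGF_of_mem_Icc (μ := Pr) (a := 0) (b := 1) hmeas.aemeasurable
    (ae_of_all _ fun ω => by by_cases hω : Z ω = x <;> simp [hω])
  rwa [integral_hit hZ hm] at h

lemma integral_centredHit {Z : Ω → Grid d L} (hZ : Measurable Z) {x : Grid d L} {m : ℝ}
    (hm : Pr.real {ω | Z ω = x} = m) : ∫ ω, centredHit x m (Z ω) ∂Pr = 0 := by
  have hmeas : Measurable fun ω => if Z ω = x then (1 : ℝ) else 0 :=
    (measurable_of_finite fun z : Grid d L => if z = x then (1 : ℝ) else 0).comp hZ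
  have hint : Integrable (fun ω => if Z ω = x then (1 : ℝ) else 0) Pr :=
    Integrable.of_mem_Icc 0 1 hmeas.aemeasurable
      (ae_of_all _ fun ω => by by_cases hω : Z ω = x <;> simp [hω])
  unfold centredHit
  rw [integral_sub hint (integrable_const _), integral_hit hZ hm]
  simp

lemma integral_sq_plugIn_sub_le {Z : ℕ → Ω → Grid d L} (hZ : ∀ k, Measurable (Z k))
    (hi : iIndepFun Z Pr) {p : Grid d L → ℝ} (hlaw : ∀ k x, Pr.real {ω | Z k ω = x} = p x)
    {n : ℕ} (hn : 1 ≤ n) (x : Grid d L) :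
    ∫ ω, (plugIn n (fun k => Z k ω) x - p x) ^ 2 ∂Pr ≤ 1 / n := by
  have hn' : (0 : ℝ) < n := by exact_mod_cast hn
  have hsub := fun k => hasSubgaussianMGF_centredHit (hZ k) (hlaw k x)
  have hL2 : ∀ k ∈ Finset.range n, MemLp (fun ω => centredHit x (p x) (Z k ω)) 2 Pr :=
    fun k _ => by exact_mod_cast (hsub k).memLp 2
  have hzero : ∫ ω, (∑ k ∈ Finset.range n, fun ω => centredHit x (p x) (Z k ω)) ω ∂Pr = 0 := by
    simp only [Finset.sum_apply]
    rw [integral_finsetSum _ fun k _ => (hsub k).integrable]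
    exact Finset.sum_eq_zero fun k _ => integral_centredHit (hZ k) (hlaw k x)
  have hmeas : ∀ k, Measurable fun ω => centredHit x (p x) (Z k ω) := fun k =>
    (measurable_of_finite (centredHit x (p x))).comp (hZ k)
  have hvar1 : ∀ k, variance (fun ω => centredHit x (p x) (Z k ω)) Pr ≤ 1 := fun k => by
    have h := variance_le_sq_of_bounded (μ := Pr) (X := fun ω => centredHit x (p x) (Z k ω))
      (a := 0 - p x) (b := 1 - p x)
      (ae_of_all _ fun ω => by by_cases hω : Z k ω = x <;> simp [hω, centredHit])
      (hmeas k).aemeasurable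
    refine h.trans ?_
    norm_num
  have hvar := IndepFun.variance_sum hL2 fun i _ j _ hij =>
    (iIndepFun_centredHit hi x (p x)).indepFun hij
  rw [variance_of_integral_eq_zero
    (memLp_finsetSum' _ hL2).aestronglyMeasurable.aemeasurable hzero] at hvar
  have heq : ∀ ω, (plugIn n (fun k => Z k ω) x - p x) ^ 2 = (1 / (n : ℝ)) ^ 2 *
      ((∑ k ∈ Finset.range n, fun ω => centredHit x (p x) (Z k ω)) ω) ^ 2 := fun ω => by
    rw [plugIn_sub_eq hn, mul_pow, Finset.sum_apply]
  simp only [heq]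
  rw [integral_const_mul]
  have hle : ∫ ω, ((∑ k ∈ Finset.range n, fun ω => centredHit x (p x) (Z k ω)) ω) ^ 2 ∂Pr ≤ n := by
    refine hvar.trans_le ?_
    calc _ ≤ ∑ _k ∈ Finset.range n, (1 : ℝ) := Finset.sum_le_sum fun k _ => hvar1 k
      _ = n := by simp
  calc _ ≤ (1 / (n : ℝ)) ^ 2 * n := mul_le_mul_of_nonneg_left hle (by positivity)
    _ = 1 / n := by field_simp

/-- Hoeffding's inequality for relative frequencies. -/
lemma measureReal_sq_plugIn_sub_le {Z : ℕ → Ω → Grid d L} (hZ : ∀ k, Measurable (Z k))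
    (hi : iIndepFun Z Pr) {p : Grid d L → ℝ} (hlaw : ∀ k x, Pr.real {ω | Z k ω = x} = p x)
    {n : ℕ} (hn : 1 ≤ n) (x : Grid d L) {t : ℝ} (ht : 0 < t) :
    Pr.real {ω | t ≤ (plugIn n (fun k => Z k ω) x - p x) ^ 2} ≤ 2 * Real.exp (-(2 * t * n)) := by
  have hn' : (0 : ℝ) < n := by exact_mod_cast hn
  have hsub := fun k => hasSubgaussianMGF_centredHit (hZ k) (hlaw k x)
  have hind := iIndepFun_centredHit hi x (p x)
  have hε : 0 ≤ (n : ℝ) * √t := by positivity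
  have hexp : -((n : ℝ) * √t) ^ 2 / (2 * n * (((‖(1 : ℝ) - 0‖₊ / 2) ^ 2 : NNReal) : ℝ))
      = -(2 * t * n) := by
    rw [mul_pow, Real.sq_sqrt ht.le]
    simp
    field_simp
  have hup := HasSubgaussianMGF.measure_sum_range_ge_le_of_iIndepFun hind (n := n)
    (fun k _ => hsub k) hε
  have hlo := HasSubgaussianMGF.measure_sum_range_ge_le_of_iIndepFun
    (X := fun k ω => -centredHit x (p x) (Z k ω)) (n := n)
    (hind.comp (fun _ y => -y) fun _ => measurable_neg) (fun k _ => (hsub k).neg) hε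
  rw [hexp] at hup hlo
  have hsubset : {ω | t ≤ (plugIn n (fun k => Z k ω) x - p x) ^ 2}
      ⊆ {ω | n * √t ≤ ∑ k ∈ Finset.range n, centredHit x (p x) (Z k ω)}
        ∪ {ω | n * √t ≤ ∑ k ∈ Finset.range n, -centredHit x (p x) (Z k ω)} := by
    intro ω hω
    have h1 : √t ≤ |plugIn n (fun k => Z k ω) x - p x| := Real.sqrt_le_iff.2
      ⟨abs_nonneg _, by rw [sq_abs]; exact hω⟩
    rw [plugIn_sub_eq hn, abs_mul, abs_of_pos (by positivity : (0 : ℝ) < 1 / n), one_div,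
      le_inv_mul_iff₀ hn', le_abs] at h1
    rcases h1 with h1 | h1
    · exact Or.inl h1
    · right
      rw [Set.mem_ofPred_eq, Finset.sum_neg_distrib]
      exact h1
  calc _ ≤ _ := measureReal_mono hsubset
    _ ≤ _ := measureReal_union_le _ _
    _ ≤ _ := add_le_add hup hlo
    _ = _ := by ring

/-! ### Functions of finitely many observations -/

/-- A function of finitely many observations takes finitely many values and has all moments. -/
lemma memLp_of_congr_lt {X Y : ℕ → Ω → Grid d L} (hX : ∀ k, Measurable (X k))
    (hY : ∀ k, Measurable (Y k)) (n : ℕ) (e : ENNReal)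
    {f : (ℕ → Grid d L) → (ℕ → Grid d L) → ℝ}
    (hf : ∀ xs xs' ys ys' : ℕ → Grid d L, (∀ k < n, xs k = xs' k) → (∀ k < n, ys k = ys' k) →
      f xs ys = f xs' ys') :
    MemLp (fun ω => f (fun k => X k ω) (fun k => Y k ω)) e Pr := by
  obtain ⟨ω₀⟩ : Nonempty Ω := nonempty_of_isProbabilityMeasure Pr
  let x₀ : Grid d L := X 0 ω₀
  let ext : (Fin n → Grid d L) → ℕ → Grid d L := fun v k => if h : k < n then v ⟨k, h⟩ else x₀
  let g : (Fin n → Grid d L) × (Fin n → Grid d L) → ℝ := fun v => f (ext v.1) (ext v.2)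
  let V : Ω → (Fin n → Grid d L) × (Fin n → Grid d L) := fun ω => (fun k => X k ω, fun k => Y k ω)
  have hV : Measurable V :=
    (measurable_pi_lambda _ fun k : Fin n => hX k).prodMk
      (measurable_pi_lambda _ fun k : Fin n => hY k)
  have heq : (fun ω => f (fun k => X k ω) (fun k => Y k ω)) = g ∘ V := by
    ext ω
    exact hf _ _ _ _ (fun k hk => by simp [ext, V, hk]) fun k hk => by simp [ext, V, hk]
  rw [heq]
  refine MemLp.of_bound ((measurable_of_finite g).comp hV).aestronglyMeasurable
    (∑ v, ‖g v‖) (ae_of_all _ fun ω => ?_)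
  exact Finset.single_le_sum (f := fun v => ‖g v‖) (fun v _ => norm_nonneg _)
    (Finset.mem_univ (V ω))

lemma plugIn_congr {n : ℕ} {z z' : ℕ → Grid d L} (h : ∀ k < n, z k = z' k) :
    plugIn n z = plugIn n z' := by
  ext x
  unfold plugIn
  congr 1
  exact Finset.sum_congr rfl fun k hk => by rw [h k (Finset.mem_range.1 hk)]

lemma adaptiveEst_congr (r : ℕ) {n : ℕ} {z z' : ℕ → Grid d L} (h : ∀ k < n, z k = z' k) :
    adaptiveEst r n z = adaptiveEst r n z' := by
  ext x
  rw [adaptiveEst, adaptiveEst, kernelEst_eq, kernelEst_eq, plugIn_congr h]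

lemma sizeN_le (μ : ℝ) (Γ : ℕ) : sizeN μ Γ ≤ Γ := Nat.sub_le _ _

lemma sizeN_add_lt {μ : ℝ} (hμ₀ : 0 < μ) (hμ₁ : μ < 1) {Γ k : ℕ} (hk : k < sizeM μ Γ) :
    sizeN μ Γ + k < Γ := by
  have := sizeM_le hμ₀ hμ₁ Γ
  unfold sizeN
  omega

lemma estP_congr {μ : ℝ} (hμ₀ : 0 < μ) (hμ₁ : μ < 1) {Γ : ℕ} (r : ℕ) {xs xs' : ℕ → Grid d L}
    (h : ∀ k < Γ, xs k = xs' k) : estP μ Γ r xs = estP μ Γ r xs' := by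
  ext x
  exact congrFun (adaptiveEst_congr r fun k hk => h _ (sizeN_add_lt hμ₀ hμ₁ hk)) x

lemma estQ_congr {μ : ℝ} (hμ₀ : 0 < μ) (hμ₁ : μ < 1) {Γ : ℕ} (r : ℕ) {ys ys' : ℕ → Grid d L}
    (h : ∀ k < Γ, ys k = ys' k) : estQ μ Γ r ys = estQ μ Γ r ys' := by
  ext x
  exact congrFun (adaptiveEst_congr r fun k hk => h _ (hk.trans_le (sizeM_le hμ₀ hμ₁ Γ))) x

lemma sampleDev_congr (p q : Grid d L → ℝ) {μ : ℝ} (hμ₀ : 0 < μ) (hμ₁ : μ < 1) {Γ : ℕ}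
    {xs xs' ys ys' : ℕ → Grid d L} (hx : ∀ k < Γ, xs k = xs' k) (hy : ∀ k < Γ, ys k = ys' k) :
    sampleDev p q μ Γ xs ys = sampleDev p q μ Γ xs' ys' := by
  unfold sampleDev
  rw [plugIn_congr fun k hk => hx k (hk.trans_le (sizeN_le μ Γ)),
    plugIn_congr (z := fun k => xs (sizeN μ Γ + k)) (z' := fun k => xs' (sizeN μ Γ + k))
      fun k hk => hx _ (sizeN_add_lt hμ₀ hμ₁ hk),
    plugIn_congr fun k hk => hy k (hk.trans_le (sizeM_le hμ₀ hμ₁ Γ))]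

lemma estD_congr {T : ℕ} (ϖ η κ : ℝ) (r : Fin T → ℕ) (w : Fin T → ℝ)
    {μ : ℝ} (hμ₀ : 0 < μ) (hμ₁ : μ < 1) {Γ : ℕ}
    {xs xs' ys ys' : ℕ → Grid d L} (hx : ∀ k < Γ, xs k = xs' k) (hy : ∀ k < Γ, ys k = ys' k) :
    estD ϖ μ η κ r w Γ xs ys = estD ϖ μ η κ r w Γ xs' ys' := by
  have hF : ensembleF ϖ μ r w Γ xs ys = ensembleF ϖ μ r w Γ xs' ys' := by
    refine Finset.sum_congr rfl fun l _ => ?_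
    rw [estF_eq, estF_eq, estP_congr hμ₀ hμ₁ _ hx, estQ_congr hμ₀ hμ₁ _ hy,
      plugIn_congr fun k hk => hx k (hk.trans_le (sizeN_le μ Γ))]
  have hdeg : Degenerate ϖ μ η r w Γ xs ys ↔ Degenerate ϖ μ η r w Γ xs' ys' := by
    unfold Degenerate
    rw [hF]
    refine or_congr (exists_congr fun l => and_congr_right fun _ => exists_congr fun i =>
      and_congr_right fun hi => ?_) Iff.rfl
    rw [estQ_congr hμ₀ hμ₁ _ hy, hx i (hi.trans_le (sizeN_le μ Γ))]
  unfold estD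
  rw [hF]
  by_cases h : Degenerate ϖ μ η r w Γ xs ys
  · rw [if_pos h, if_pos (hdeg.1 h)]
  · rw [if_neg h, if_neg (mt hdeg.2 h)]

/-! ### The size of `sampleDev` -/

lemma integrable_sampleDev {X Y : ℕ → Ω → Grid d L} (hX : ∀ k, Measurable (X k))
    (hY : ∀ k, Measurable (Y k)) (p q : Grid d L → ℝ) {μ : ℝ} (hμ₀ : 0 < μ) (hμ₁ : μ < 1)
    (Γ : ℕ) : Integrable (fun ω => sampleDev p q μ Γ (fun k => X k ω) (fun k => Y k ω)) Pr :=
  (memLp_of_congr_lt hX hY Γ 1 fun _ _ _ _ => sampleDev_congr p q hμ₀ hμ₁).integrable le_rfl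

lemma exists_integral_sampleDev_le {X Y : ℕ → Ω → Grid d L} (hX : ∀ k, Measurable (X k))
    (hY : ∀ k, Measurable (Y k)) (hXi : iIndepFun X Pr) (hYi : iIndepFun Y Pr)
    {p q : Grid d L → ℝ} (hXl : ∀ k x, Pr.real {ω | X k ω = x} = p x)
    (hYl : ∀ k x, Pr.real {ω | Y k ω = x} = q x) {μ : ℝ} (hμ₀ : 0 < μ) (hμ₁ : μ < 1) :
    ∃ C : ℝ, ∀ᶠ Γ : ℕ in atTop,
      ∫ ω, sampleDev p q μ Γ (fun k => X k ω) (fun k => Y k ω) ∂Pr ≤ C * ((Γ : ℝ))⁻¹ := by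
  refine ⟨Fintype.card (Grid d L) * (1 / (1 - μ) + 2 / μ + 2 / μ), ?_⟩
  filter_upwards [eventually_sizeM_ge hμ₀, eventually_ge_atTop 1] with Γ hM hΓ1
  have hΓ0 : (0 : ℝ) < Γ := by exact_mod_cast hΓ1
  have hN := sizeN_ge hμ₀ hμ₁ Γ
  have hμ' : 0 < 1 - μ := by linarith
  have hM1 : 1 ≤ sizeM μ Γ := by
    have : (0 : ℝ) < sizeM μ Γ := lt_of_lt_of_le (by positivity) hM
    exact_mod_cast this
  have hN1 : 1 ≤ sizeN μ Γ := by
    have : (0 : ℝ) < sizeN μ Γ := lt_of_lt_of_le (by positivity) hN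
    exact_mod_cast this
  have hshift : iIndepFun (fun k => X (sizeN μ Γ + k)) Pr :=
    hXi.precomp (add_right_injective (sizeN μ Γ))
  have hNinv : 1 / (sizeN μ Γ : ℝ) ≤ 1 / (1 - μ) * ((Γ : ℝ))⁻¹ := by
    rw [← one_div, one_div_mul_one_div]
    exact one_div_le_one_div_of_le (by positivity) hN
  have hMinv : 1 / (sizeM μ Γ : ℝ) ≤ 2 / μ * ((Γ : ℝ))⁻¹ := by
    calc _ ≤ 1 / (μ / 2 * Γ) := one_div_le_one_div_of_le (by positivity) hM
      _ = _ := by field_simp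
  have hL1 : ∀ x, Integrable (fun ω => (plugIn (sizeN μ Γ) (fun k => X k ω) x - p x) ^ 2) Pr :=
    fun x => (memLp_of_congr_lt hX hY (sizeN μ Γ) 1
      (f := fun xs _ => (plugIn (sizeN μ Γ) xs x - p x) ^ 2)
      fun _ _ _ _ hx _ => by rw [plugIn_congr hx]).integrable le_rfl
  have hL2 : ∀ x, Integrable (fun ω =>
      (plugIn (sizeM μ Γ) (fun k => X (sizeN μ Γ + k) ω) x - p x) ^ 2) Pr :=
    fun x => (memLp_of_congr_lt (fun k => hX (sizeN μ Γ + k)) hY (sizeM μ Γ) 1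
      (f := fun xs _ => (plugIn (sizeM μ Γ) xs x - p x) ^ 2)
      fun _ _ _ _ hx _ => by rw [plugIn_congr hx]).integrable le_rfl
  have hL3 : ∀ x, Integrable (fun ω => (plugIn (sizeM μ Γ) (fun k => Y k ω) x - q x) ^ 2) Pr :=
    fun x => (memLp_of_congr_lt hX hY (sizeM μ Γ) 1
      (f := fun _ ys => (plugIn (sizeM μ Γ) ys x - q x) ^ 2)
      fun _ _ _ _ _ hy => by rw [plugIn_congr hy]).integrable le_rfl
  have hL : ∀ x, Integrable (fun ω => (plugIn (sizeN μ Γ) (fun k => X k ω) x - p x) ^ 2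
      + (plugIn (sizeM μ Γ) (fun k => X (sizeN μ Γ + k) ω) x - p x) ^ 2
      + (plugIn (sizeM μ Γ) (fun k => Y k ω) x - q x) ^ 2) Pr :=
    fun x => ((hL1 x).add (hL2 x)).add (hL3 x)
  unfold sampleDev
  rw [integral_finsetSum _ fun x _ => hL x]
  calc _ ≤ ∑ _x : Grid d L, (1 / (1 - μ) + 2 / μ + 2 / μ) * ((Γ : ℝ))⁻¹ := by
        refine Finset.sum_le_sum fun x _ => ?_
        have h1 := integral_add ((hL1 x).add (hL2 x)) (hL3 x)
        have h2 := integral_add (hL1 x) (hL2 x)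
        simp only [Pi.add_apply] at h1
        rw [h1, h2]
        have e1 := integral_sq_plugIn_sub_le hX hXi hXl hN1 x
        have e2 := integral_sq_plugIn_sub_le (fun k => hX (sizeN μ Γ + k)) hshift
          (fun k x => hXl (sizeN μ Γ + k) x) hM1 x
        have e3 := integral_sq_plugIn_sub_le hY hYi hYl hM1 x
        linarith
    _ = _ := by
        simp
        ring

/-- Large deviations of the relative frequencies are exponentially unlikely. -/
lemma exists_measureReal_sampleDev_le {X Y : ℕ → Ω → Grid d L} (hX : ∀ k, Measurable (X k))
    (hY : ∀ k, Measurable (Y k)) (hXi : iIndepFun X Pr) (hYi : iIndepFun Y Pr)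
    {p q : Grid d L → ℝ} (hXl : ∀ k x, Pr.real {ω | X k ω = x} = p x)
    (hYl : ∀ k x, Pr.real {ω | Y k ω = x} = q x) {μ : ℝ} (hμ₀ : 0 < μ) (hμ₁ : μ < 1)
    {δ : ℝ} (hδ : 0 < δ) :
    ∃ C c : ℝ, 0 < c ∧ ∀ᶠ Γ : ℕ in atTop,
      Pr.real {ω | δ < sampleDev p q μ Γ (fun k => X k ω) (fun k => Y k ω)}
        ≤ C * Real.exp (-c * (Γ : ℝ)) := by
  obtain ⟨ω₀⟩ : Nonempty Ω := nonempty_of_isProbabilityMeasure Pr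
  have : Nonempty (Grid d L) := ⟨X 0 ω₀⟩
  set g : ℝ := (Fintype.card (Grid d L) : ℝ) with hg
  have hg0 : 0 < g := by
    rw [hg]
    exact_mod_cast Fintype.card_pos
  set t : ℝ := δ / (3 * g) with ht
  have ht0 : 0 < t := by positivity
  have hμ' : 0 < 1 - μ := by linarith
  set c : ℝ := 2 * t * min (1 - μ) (μ / 2) with hc
  have hc0 : 0 < c := mul_pos (by positivity) (lt_min hμ' (by positivity))
  refine ⟨g * 6, c, hc0, ?_⟩
  filter_upwards [eventually_sizeM_ge hμ₀, eventually_ge_atTop 1] with Γ hM hΓ1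
  have hΓ0 : (0 : ℝ) < Γ := by exact_mod_cast hΓ1
  have hN := sizeN_ge hμ₀ hμ₁ Γ
  have hM1 : 1 ≤ sizeM μ Γ := by
    have : (0 : ℝ) < sizeM μ Γ := lt_of_lt_of_le (by positivity) hM
    exact_mod_cast this
  have hN1 : 1 ≤ sizeN μ Γ := by
    have : (0 : ℝ) < sizeN μ Γ := lt_of_lt_of_le (by positivity) hN
    exact_mod_cast this
  have hshift : iIndepFun (fun k => X (sizeN μ Γ + k)) Pr :=
    hXi.precomp (add_right_injective (sizeN μ Γ))
  have hexp : ∀ n : ℕ, min (1 - μ) (μ / 2) * (Γ : ℝ) ≤ n →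
      2 * Real.exp (-(2 * t * n)) ≤ 2 * Real.exp (-c * (Γ : ℝ)) := fun n hn => by
    refine mul_le_mul_of_nonneg_left (Real.exp_le_exp.2 ?_) zero_le_two
    have := mul_le_mul_of_nonneg_left hn (by positivity : 0 ≤ 2 * t)
    rw [hc]
    linarith
  have hN' : min (1 - μ) (μ / 2) * (Γ : ℝ) ≤ sizeN μ Γ :=
    (mul_le_mul_of_nonneg_right (min_le_left _ _) hΓ0.le).trans hN
  have hM' : min (1 - μ) (μ / 2) * (Γ : ℝ) ≤ sizeM μ Γ :=
    (mul_le_mul_of_nonneg_right (min_le_right _ _) hΓ0.le).trans hM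
  have hsubset : {ω | δ < sampleDev p q μ Γ (fun k => X k ω) (fun k => Y k ω)} ⊆
      ⋃ x : Grid d L, ({ω | t ≤ (plugIn (sizeN μ Γ) (fun k => X k ω) x - p x) ^ 2} ∪
        {ω | t ≤ (plugIn (sizeM μ Γ) (fun k => X (sizeN μ Γ + k) ω) x - p x) ^ 2}) ∪
        {ω | t ≤ (plugIn (sizeM μ Γ) (fun k => Y k ω) x - q x) ^ 2} := by
    intro ω hω
    by_contra hcon
    simp only [Set.mem_iUnion, Set.mem_union, Set.mem_ofPred_eq, not_exists, not_or, not_le]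
      at hcon hω
    have : sampleDev p q μ Γ (fun k => X k ω) (fun k => Y k ω) ≤ ∑ _x : Grid d L, (t + t + t) :=
      Finset.sum_le_sum fun x _ => by
        obtain ⟨⟨h1, h2⟩, h3⟩ := hcon x
        linarith
    have hsum : ∑ _x : Grid d L, (t + t + t) = δ := by
      simp only [Finset.sum_const, Finset.card_univ, nsmul_eq_mul, ← hg, ht]
      field_simp
      norm_num
    linarith
  calc _ ≤ _ := measureReal_mono hsubset
    _ ≤ _ := measureReal_iUnion_fintype_le _
    _ ≤ ∑ _x : Grid d L, 6 * Real.exp (-c * (Γ : ℝ)) := by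
        refine Finset.sum_le_sum fun x _ => ?_
        have e1 := (measureReal_sq_plugIn_sub_le hX hXi hXl hN1 x ht0).trans (hexp _ hN')
        have e2 := (measureReal_sq_plugIn_sub_le (fun k => hX (sizeN μ Γ + k)) hshift
          (fun k x => hXl (sizeN μ Γ + k) x) hM1 x ht0).trans (hexp _ hM')
        have e3 := (measureReal_sq_plugIn_sub_le hY hYi hYl hM1 x ht0).trans (hexp _ hM')
        refine (measureReal_union_le _ _).trans ?_
        have := measureReal_union_le (μ := Pr)
          {ω | t ≤ (plugIn (sizeN μ Γ) (fun k => X k ω) x - p x) ^ 2}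
          {ω | t ≤ (plugIn (sizeM μ Γ) (fun k => X (sizeN μ Γ + k) ω) x - p x) ^ 2}
        linarith
    _ = _ := by
        simp [hg]
        ring

/-! ### Optimal weights -/

/-- The weight vectors summing to one with `‖w‖² ≤ ε` form a compact set, which contains the
uniform weights, and the least level `δ` feasible with `w` is the largest of the `d` constraint
values, a continuous function of `w`. -/
lemma exists_isOptimalWeight {T : ℕ} (hd : 1 ≤ d) (hT : 1 ≤ T) (μ : ℝ) {ε : ℝ}
    (hε : 1 / (T : ℝ) ≤ ε) (r : Fin T → ℕ) (Γ : ℕ) :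
    ∃ w : Fin T → ℝ, IsOptimalWeight d L μ ε r Γ w := by
  let S : Set (Fin T → ℝ) := {w | ∑ l, w l = 1 ∧ ∑ l, w l ^ 2 ≤ ε}
  have hT0 : (T : ℝ) ≠ 0 := by positivity
  have hne : S.Nonempty := by
    refine ⟨fun _ => 1 / (T : ℝ), ?_, ?_⟩
    · simp [hT0]
    · refine le_trans (le_of_eq ?_) hε
      simp only [Finset.sum_const, Finset.card_univ, Fintype.card_fin, nsmul_eq_mul]
      field_simp
  have hclosed : IsClosed S :=
    (isClosed_eq (f := fun w : Fin T → ℝ => ∑ l, w l) (by fun_prop) continuous_const).inter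
      (isClosed_le (f := fun w : Fin T → ℝ => ∑ l, w l ^ 2) (by fun_prop) continuous_const)
  have hbdd : S ⊆ Set.Icc (fun _ => -√ε) fun _ => √ε := by
    intro w hw
    have h : ∀ l, |w l| ≤ √ε := fun l => Real.abs_le_sqrt
      ((Finset.single_le_sum (f := fun l => w l ^ 2) (fun _ _ => sq_nonneg _)
        (Finset.mem_univ l)).trans hw.2)
    exact ⟨fun l => (abs_le.1 (h l)).1, fun l => (abs_le.1 (h l)).2⟩
  have hcomp : IsCompact S := isCompact_Icc.of_isClosed_subset hclosed hbdd
  have hJ : (Finset.Icc 1 d).Nonempty := ⟨1, by simpa using hd⟩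
  let f : ℕ → (Fin T → ℝ) → ℝ := fun j w =>
    |∑ l, w l * phi d L μ Γ (r l) j * (Γ : ℝ) ^ (1 / 2 - (j : ℝ) / (2 * (d : ℝ)))|
  have hcont : Continuous fun w => (Finset.Icc 1 d).sup' hJ fun j => f j w :=
    Continuous.finset_sup'_apply hJ fun j _ => by
      simp only [f]
      fun_prop
  obtain ⟨w, hw, hmin⟩ := hcomp.exists_isMinOn hne hcont.continuousOn
  refine ⟨w, (Finset.Icc 1 d).sup' hJ fun j => f j w,
    ⟨hw.1, fun j hj => Finset.le_sup' (fun j => f j w) hj, hw.2⟩, fun w' δ' h => ?_⟩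
  exact (hmin (show w' ∈ S from ⟨h.1, h.2.2⟩)).trans (Finset.sup'_le hJ _ h.2.1)

/-! ### The mean squared error -/

lemma memLp_estD {T : ℕ} {X Y : ℕ → Ω → Grid d L} (hX : ∀ k, Measurable (X k))
    (hY : ∀ k, Measurable (Y k)) (ϖ η κ : ℝ) (r : Fin T → ℕ) (w : Fin T → ℝ)
    {μ : ℝ} (hμ₀ : 0 < μ) (hμ₁ : μ < 1) (Γ : ℕ) :
    MemLp (fun ω => estD ϖ μ η κ r w Γ (fun k => X k ω) (fun k => Y k ω)) 2 Pr :=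
  memLp_of_congr_lt hX hY Γ 2 fun _ _ _ _ => estD_congr ϖ η κ r w hμ₀ hμ₁

lemma isBigO_pow_mul_exp_neg (n : ℕ) {c : ℝ} (hc : 0 < c) :
    (fun Γ : ℕ => (Γ : ℝ) ^ n * Real.exp (-c * Γ)) =O[atTop] fun Γ : ℕ => ((Γ : ℝ))⁻¹ := by
  have h := ((isLittleO_exp_neg_mul_rpow_atTop hc (-(n + 1 : ℝ))).comp_tendsto
    tendsto_natCast_atTop_atTop).isBigO
  refine ((isBigO_refl (fun Γ : ℕ => (Γ : ℝ) ^ n) atTop).mul h).congr' (by rfl) ?_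
  filter_upwards [eventually_ge_atTop 1] with Γ hΓ
  have hΓ0 : (0 : ℝ) < Γ := by exact_mod_cast hΓ
  simp only [Function.comp_apply]
  rw [Real.rpow_neg hΓ0.le, Real.rpow_add_one hΓ0.ne', Real.rpow_natCast]
  field_simp

/-- The rates for weights that sum to one and stay bounded; no other property of the weights
matters. The bound `exists_sq_error_le` is used on samples with small `sampleDev`, and
`exists_abs_error_le` on the exceptional ones, whose exponentially small probability absorbs the
polynomial growth of the error. -/
theorem isBigO_degenerate_and_mse {T : ℕ} (hT : 1 ≤ T) (hd : 1 ≤ d) {r : Fin T → ℕ}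
    (hr : ∀ l, 1 ≤ r l) {ϖ μ η B : ℝ} (κ : ℝ) (hϖ : 0 < ϖ) (hμ₀ : 0 < μ) (hμ₁ : μ < 1)
    (hη₀ : 0 < η) (hη₁ : η < Real.exp ϖ) (hB : 1 ≤ B)
    {p q : Grid d L → ℝ} (hp : IsPmf p) (hq : IsPmf q) (hq_pos : ∀ x, 0 < q x)
    {X Y : ℕ → Ω → Grid d L} (hX : ∀ k, Measurable (X k)) (hY : ∀ k, Measurable (Y k))
    (hXl : ∀ k x, Pr.real {ω | X k ω = x} = p x) (hYl : ∀ k x, Pr.real {ω | Y k ω = x} = q x)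
    (hXi : iIndepFun X Pr) (hYi : iIndepFun Y Pr)
    {w : ℕ → Fin T → ℝ} (hw1 : ∀ Γ, ∑ l, w Γ l = 1) (hwB : ∀ Γ l, |w Γ l| ≤ B) :
    (∃ c : ℝ, 0 < c ∧
      (fun Γ : ℕ => Pr.real {ω | Degenerate ϖ μ η r (w Γ) Γ (fun k => X k ω) (fun k => Y k ω)})
        =O[atTop] fun Γ : ℕ => Real.exp (-c * (Γ : ℝ))) ∧
    (fun Γ : ℕ => ∫ ω, (estD ϖ μ η κ r (w Γ) Γ (fun k => X k ω) (fun k => Y k ω)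
      - miDivergence ϖ p q) ^ 2 ∂Pr) =O[atTop] fun Γ : ℕ => ((Γ : ℝ))⁻¹ := by
  obtain ⟨C₁, δ, hδ, h₁⟩ := exists_sq_error_le hd hr κ hϖ hμ₀ hη₀ hη₁
    (zero_le_one.trans hB) hp hq hq_pos
  obtain ⟨C₂, h₂⟩ := exists_abs_error_le (L := L) hT hd hr κ (miDivergence ϖ p q) hϖ hμ₀ hμ₁ hη₀ hB
  obtain ⟨C₃, h₃⟩ := exists_integral_sampleDev_le hX hY hXi hYi hXl hYl hμ₀ hμ₁
  obtain ⟨C₄, c, hc, h₄⟩ := exists_measureReal_sampleDev_le hX hY hXi hYi hXl hYl hμ₀ hμ₁ hδ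
  constructor
  · refine ⟨c, hc, IsBigO.of_bound C₄ ?_⟩
    filter_upwards [h₁, h₄] with Γ h1 h4
    rw [Real.norm_of_nonneg measureReal_nonneg, Real.norm_of_nonneg (Real.exp_pos _).le]
    refine (measureReal_mono fun ω hω => ?_).trans h4
    by_contra hcon
    exact (h1 (w Γ) (hw1 Γ) (hwB Γ) _ _ (not_lt.1 hcon)).1 hω
  · have hbound : (fun Γ : ℕ => ∫ ω, (estD ϖ μ η κ r (w Γ) Γ (fun k => X k ω) (fun k => Y k ω)
        - miDivergence ϖ p q) ^ 2 ∂Pr) =O[atTop]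
        fun Γ : ℕ => |C₁| * (C₃ * ((Γ : ℝ))⁻¹ + ((Γ : ℝ) ^ 2)⁻¹)
          + C₂ ^ 2 * ((Γ : ℝ) ^ 8 * (C₄ * Real.exp (-c * (Γ : ℝ)))) := by
      refine IsBigO.of_bound' ?_
      filter_upwards [h₁, h₂, h₃, h₄] with Γ h1 h2 h3 h4
      set V : Ω → ℝ := fun ω => sampleDev p q μ Γ (fun k => X k ω) (fun k => Y k ω) with hV
      have hVint : Integrable V Pr := integrable_sampleDev hX hY p q hμ₀ hμ₁ Γ
      have hV0 : ∀ ω, 0 ≤ V ω := fun ω => sampleDev_nonneg _ _ _ _ _ _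
      set A : Set Ω := {ω | δ < V ω} with hA
      have hAm : MeasurableSet A := by
        have hcl : Measurable V := by
          simp only [hV, sampleDev, plugIn]
          have hhit : ∀ (Z : Ω → Grid d L), Measurable Z → ∀ x, Measurable fun ω =>
              if Z ω = x then (1 : ℝ) else 0 := fun Z hZ x =>
            (measurable_of_finite fun z : Grid d L => if z = x then (1 : ℝ) else 0).comp hZ
          have hX' := fun k x => hhit _ (hX k) x
          have hY' := fun k x => hhit _ (hY k) x
          fun_prop
        exact measurableSet_lt measurable_const hcl
      have hpt : ∀ ω, (estD ϖ μ η κ r (w Γ) Γ (fun k => X k ω) (fun k => Y k ω)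
          - miDivergence ϖ p q) ^ 2 ≤ |C₁| * (V ω + ((Γ : ℝ) ^ 2)⁻¹)
            + A.indicator (fun _ => C₂ ^ 2 * (Γ : ℝ) ^ 8) ω := by
        intro ω
        have hpos : 0 ≤ V ω + ((Γ : ℝ) ^ 2)⁻¹ := add_nonneg (hV0 ω) (by positivity)
        by_cases hω : ω ∈ A
        · rw [Set.indicator_of_mem hω, ← sq_abs]
          have := pow_le_pow_left₀ (abs_nonneg _)
            (h2 (w Γ) (hwB Γ) (fun k => X k ω) (fun k => Y k ω)) 2
          have h0 : 0 ≤ |C₁| * (V ω + ((Γ : ℝ) ^ 2)⁻¹) := mul_nonneg (abs_nonneg _) hpos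
          calc _ ≤ (C₂ * (Γ : ℝ) ^ 4) ^ 2 := this
            _ = C₂ ^ 2 * (Γ : ℝ) ^ 8 := by ring
            _ ≤ _ := le_add_of_nonneg_left h0
        · rw [Set.indicator_of_notMem hω, add_zero]
          refine (h1 (w Γ) (hw1 Γ) (hwB Γ) _ _ (not_lt.1 hω)).2.trans ?_
          exact mul_le_mul_of_nonneg_right (le_abs_self _) hpos
      have hi1 : Integrable (fun ω => |C₁| * (V ω + ((Γ : ℝ) ^ 2)⁻¹)) Pr :=
        (hVint.add (integrable_const _)).const_mul _
      have hi2 : Integrable (A.indicator fun _ => C₂ ^ 2 * (Γ : ℝ) ^ 8) Pr :=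
        (integrable_const _).indicator hAm
      have hi0 : Integrable (fun ω => (estD ϖ μ η κ r (w Γ) Γ (fun k => X k ω) (fun k => Y k ω)
          - miDivergence ϖ p q) ^ 2) Pr :=
        ((memLp_estD hX hY ϖ η κ r (w Γ) hμ₀ hμ₁ Γ).sub (memLp_const _)).integrable_sq
      have hint : ∫ ω, (estD ϖ μ η κ r (w Γ) Γ (fun k => X k ω) (fun k => Y k ω)
          - miDivergence ϖ p q) ^ 2 ∂Pr
          ≤ |C₁| * (C₃ * ((Γ : ℝ))⁻¹ + ((Γ : ℝ) ^ 2)⁻¹)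
            + C₂ ^ 2 * ((Γ : ℝ) ^ 8 * (C₄ * Real.exp (-c * (Γ : ℝ)))) := by
        refine (integral_mono hi0 (hi1.add hi2) hpt).trans ?_
        rw [integral_add' hi1 hi2, integral_const_mul, integral_add hVint (integrable_const _),
          integral_indicator_const _ hAm, integral_const, probReal_univ, one_smul, smul_eq_mul]
        refine add_le_add
          (mul_le_mul_of_nonneg_left (add_le_add_left h3 _) (abs_nonneg _)) ?_
        calc Pr.real A * (C₂ ^ 2 * (Γ : ℝ) ^ 8)
            ≤ C₄ * Real.exp (-c * (Γ : ℝ)) * (C₂ ^ 2 * (Γ : ℝ) ^ 8) :=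
              mul_le_mul_of_nonneg_right h4 (by positivity)
          _ = _ := by ring
      rw [Real.norm_of_nonneg (integral_nonneg fun ω => sq_nonneg _)]
      exact hint.trans (le_abs_self _)
    refine hbound.trans (IsBigO.add (IsBigO.const_mul_left (IsBigO.add ?_ ?_) _)
      (IsBigO.const_mul_left ?_ _))
    · exact (isBigO_refl _ _).const_mul_left _
    · refine IsBigO.of_bound' ?_
      filter_upwards [eventually_ge_atTop 1] with Γ hΓ
      have hΓ1 : (1 : ℝ) ≤ Γ := by exact_mod_cast hΓ
      rw [Real.norm_of_nonneg (by positivity), Real.norm_of_nonneg (by positivity)]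
      exact inv_anti₀ (by linarith) (le_self_pow₀ hΓ1 two_ne_zero)
    · exact ((isBigO_pow_mul_exp_neg 8 hc).const_mul_left C₄).congr_left fun Γ => by ring

lemma isBigO_inv_rpow {j : ℝ} (hj : j ≤ d) :
    (fun Γ : ℕ => ((Γ : ℝ))⁻¹) =O[atTop] fun Γ : ℕ => (Γ : ℝ) ^ (-(j / (d : ℝ))) := by
  refine IsBigO.of_bound' ?_
  filter_upwards [eventually_ge_atTop 1] with Γ hΓ
  have hΓ1 : (1 : ℝ) ≤ Γ := by exact_mod_cast hΓ
  rw [Real.norm_of_nonneg (by positivity), Real.norm_of_nonneg (by positivity),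
    ← Real.rpow_neg_one]
  exact Real.rpow_le_rpow_of_exponent_le hΓ1
    (neg_le_neg (div_le_one_of_le₀ hj (Nat.cast_nonneg d)))

lemma isLittleO_inv_rpow {j : ℝ} (hd : 1 ≤ d) (hj : j < d) :
    (fun Γ : ℕ => ((Γ : ℝ))⁻¹) =o[atTop] fun Γ : ℕ => (Γ : ℝ) ^ (-(j / (d : ℝ))) := by
  have hd0 : (0 : ℝ) < d := by exact_mod_cast hd
  have h := (tendsto_rpow_neg_atTop (sub_pos.2 ((div_lt_one hd0).2 hj))).comp
    (tendsto_natCast_atTop_atTop (R := ℝ))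
  refine (isLittleO_iff_tendsto' ?_).2 (h.congr' ?_)
  · filter_upwards [eventually_ge_atTop 1] with Γ hΓ h0
    have hΓ0 : (0 : ℝ) < Γ := by exact_mod_cast hΓ
    exact absurd h0 (Real.rpow_pos_of_pos hΓ0 _).ne'
  · filter_upwards [eventually_ge_atTop 1] with Γ hΓ
    have hΓ0 : (0 : ℝ) < Γ := by exact_mod_cast hΓ
    rw [Function.comp_apply, ← Real.rpow_neg_one, ← Real.rpow_sub hΓ0]
    ring_nf

end MIDiv

theorem mainTheorem9 {Ω : Type*} [MeasurableSpace Ω] (Pr : Measure Ω) [IsProbabilityMeasure Pr]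
    (d L T : ℕ) (hd : 1 ≤ d) (hT : d + 1 ≤ T)
    (r : Fin T → ℕ) (hr_pos : ∀ l, 1 ≤ r l) (hr_lt : ∀ l, (r l : ℝ) < ((L : ℝ) - 1) / 2)
    (ϖ μ ε η κ : ℝ) (hϖ : 0 < ϖ) (hμ₀ : 0 < μ) (hμ₁ : μ < 1) (hε : 1 / (T : ℝ) ≤ ε)
    (hη₀ : 0 < η) (hη₁ : η < Real.exp ϖ)
    (p q : MIDiv.Grid d L → ℝ) (hp : MIDiv.IsPmf p) (hq : MIDiv.IsPmf q) (hq_pos : ∀ x, 0 < q x)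
    (X Y : ℕ → Ω → MIDiv.Grid d L)
    (hX_meas : ∀ k, Measurable (X k)) (hY_meas : ∀ k, Measurable (Y k))
    (hX_law : ∀ k x, Pr.real {ω | X k ω = x} = p x)
    (hY_law : ∀ k x, Pr.real {ω | Y k ω = x} = q x)
    (hX_indep : iIndepFun X Pr) (hY_indep : iIndepFun Y Pr) :
    -- optimal weight vectors exist for every sample size
    (∀ Γ : ℕ, ∃ w : Fin T → ℝ, MIDiv.IsOptimalWeight d L μ ε r Γ w) ∧
    -- the optimally weighted ensemble estimator
    (∀ w : ℕ → Fin T → ℝ, (∀ Γ, MIDiv.IsOptimalWeight d L μ ε r Γ (w Γ)) →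
      (∃ c : ℝ, 0 < c ∧
        (fun Γ : ℕ => Pr.real {ω | MIDiv.Degenerate ϖ μ η r (w Γ) Γ
          (fun k => X k ω) (fun k => Y k ω)}) =O[atTop] fun Γ : ℕ => Real.exp (-c * (Γ : ℝ))) ∧
      (∀ Γ : ℕ, MemLp (fun ω => MIDiv.estD ϖ μ η κ r (w Γ) Γ
          (fun k => X k ω) (fun k => Y k ω)) 2 Pr) ∧
      (fun Γ : ℕ => ∫ ω, (MIDiv.estD ϖ μ η κ r (w Γ) Γ (fun k => X k ω) (fun k => Y k ω)
          - MIDiv.miDivergence ϖ p q) ^ 2 ∂Pr) =O[atTop] fun Γ : ℕ => ((Γ : ℝ))⁻¹) ∧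
    -- the individual estimators, and the comparison of the two rates
    (∀ l : Fin T, ∀ j : ℝ, 0 < j → j ≤ d →
      (∀ Γ : ℕ, MemLp (fun ω => MIDiv.estD ϖ μ η κ r (Pi.single l 1) Γ
          (fun k => X k ω) (fun k => Y k ω)) 2 Pr) ∧
      (fun Γ : ℕ => ∫ ω, (MIDiv.estD ϖ μ η κ r (Pi.single l 1) Γ
          (fun k => X k ω) (fun k => Y k ω)
          - MIDiv.miDivergence ϖ p q) ^ 2 ∂Pr) =O[atTop]
            fun Γ : ℕ => (Γ : ℝ) ^ (-(j / (d : ℝ)))) ∧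
    (∀ j : ℝ, 0 < j → j < d →
      (fun Γ : ℕ => ((Γ : ℝ))⁻¹) =o[atTop] fun Γ : ℕ => (Γ : ℝ) ^ (-(j / (d : ℝ)))) := by
  have hT1 : 1 ≤ T := by omega
  refine ⟨MIDiv.exists_isOptimalWeight hd hT1 μ hε r, fun w hw => ?_, fun l j _ hj => ?_,
    fun j _ hj => MIDiv.isLittleO_inv_rpow hd hj⟩
  · have hw1 : ∀ Γ, ∑ l, w Γ l = 1 := fun Γ => by
      obtain ⟨δ, h, -⟩ := hw Γ
      exact h.1
    have hwB : ∀ Γ l, |w Γ l| ≤ max 1 √ε := fun Γ l => by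
      obtain ⟨δ, h, -⟩ := hw Γ
      refine (Real.abs_le_sqrt ?_).trans (le_max_right _ _)
      exact (Finset.single_le_sum (f := fun l => w Γ l ^ 2) (fun _ _ => sq_nonneg _)
        (Finset.mem_univ l)).trans h.2.2
    obtain ⟨hdeg, hmse⟩ := MIDiv.isBigO_degenerate_and_mse hT1 hd hr_pos κ hϖ hμ₀ hμ₁ hη₀ hη₁
      (le_max_left 1 √ε) hp hq hq_pos hX_meas hY_meas hX_law hY_law hX_indep hY_indep hw1 hwB
    exact ⟨hdeg, fun Γ => MIDiv.memLp_estD hX_meas hY_meas ϖ η κ r (w Γ) hμ₀ hμ₁ Γ, hmse⟩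
  · have hw1 : ∀ _Γ : ℕ, ∑ l', (Pi.single l 1 : Fin T → ℝ) l' = 1 := fun _ => by simp
    have hwB : ∀ (_Γ : ℕ) l', |(Pi.single l 1 : Fin T → ℝ) l'| ≤ 1 := fun _ l' => by
      by_cases h : l' = l
      · simp [h]
      · simp [h]
    have hmse := (MIDiv.isBigO_degenerate_and_mse hT1 hd hr_pos κ hϖ hμ₀ hμ₁ hη₀ hη₁
      le_rfl hp hq hq_pos hX_meas hY_meas hX_law hY_law hX_indep hY_indep
      (w := fun _ => Pi.single l 1) hw1 hwB).2
    exact ⟨fun Γ => MIDiv.memLp_estD hX_meas hY_meas ϖ η κ r _ hμ₀ hμ₁ Γ,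
      hmse.trans (MIDiv.isBigO_inv_rpow hj)⟩
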